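/- Let $n\ge 1$ and let $\mathbb S^n\subset\mathbb R^{n+1}$ be the unit sphere with its standard round metric, $\Delta=-\operatorname{div}\circ\operatorname{grad}$ its Laplace--Beltrami operator and $\operatorname{Vol}$ its Riemannian volume. A nodal domain of a (smooth, not identically zero) eigenfunction $\varphi$ of $\Delta$ is a connected component of $\{\varphi\neq 0\}$. There is a constant $C=C(n)>0$, depending only on $n$, such that for every eigenvalue $\lambda$ of $\Delta$ and every $R>0$ with $R<1/\sqrt\lambda$ there exist an eigenfunction $\varphi$ with $\Delta\varphi=\lambda\varphi$, a nodal domain $A$ of $\varphi$, and a geodesic ball $B\subset\mathbb S^n$ of radius $R$ such that $$A\cap \tfrac12 B\neq\emptyset\qquad\text{and}\qquad \frac{\operatorname{Vol}(A\cap B)}{\operatorname{Vol}(B)}\le\frac{C}{(\sqrt\lambda)^{n-1}},$$ where $\tfrac12 B$ is the ball of radius $R/2$ concentric with $B$. (For $\lambda=0$ the condition $R<1/\sqrt\lambda$ is read as no restriction on $R$, and the right-hand side as $+\infty$ if $n\ge2$ and as $C$ if $n=1$.) -/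

import Mathlib

open MeasureTheory Metric
open scoped Manifold ContDiff

noncomputable section

namespace RoundSphere

/-- The ambient Euclidean space `ℝⁿ⁺¹`. -/
abbrev Ambient (n : ℕ) : Type := EuclideanSpace ℝ (Fin (n + 1))

/-- The unit sphere `Sⁿ ⊆ ℝⁿ⁺¹`. -/
abbrev Sph (n : ℕ) : Type := Metric.sphere (0 : Ambient n) 1

instance factFinrankAmbient (n : ℕ) : Fact (Module.finrank ℝ (Ambient n) = n + 1) :=
  ⟨finrank_euclideanSpace_fin⟩

/-- The extension `x ↦ f (x / ‖x‖)` of a map on `Sⁿ` to `ℝⁿ⁺¹ ∖ {0}`, constant along rays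
(with value `0` at the origin, which plays no role). -/
def radialExt {n : ℕ} {F : Type*} [Zero F] (f : Sph n → F) (x : Ambient n) : F :=
  open Classical in
  if h : x ≠ 0 then
    f ⟨‖x‖⁻¹ • x, by
      rw [mem_sphere_zero_iff_norm, norm_smul, norm_inv, norm_norm,
        inv_mul_cancel₀ (norm_ne_zero_iff.mpr h)]⟩
  else 0

/-- The Riemannian gradient of a function on the round sphere, as a vector of `ℝⁿ⁺¹`.
Since the extension is constant along rays, its Euclidean gradient at a point `p` of the sphere
is tangent to the sphere at `p`. -/
def grad {n : ℕ} (f : Sph n → ℝ) (p : Sph n) : Ambient n :=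
  gradient (radialExt f) (p : Ambient n)

/-- The Riemannian divergence of a tangent vector field on the round sphere. The Levi-Civita
connection of the sphere is the tangential part of the Euclidean derivative, so the divergence at
`p` is the sum of `⟪D_e X, e⟫` over an orthonormal basis `e` of the tangent space at `p`; the
extension of `X` has derivative zero in the normal direction `p`, so this sum is the full trace. -/
def div {n : ℕ} (X : Sph n → Ambient n) (p : Sph n) : ℝ :=
  LinearMap.trace ℝ (Ambient n)
    (fderiv ℝ (radialExt X) (p : Ambient n) : Ambient n →ₗ[ℝ] Ambient n)

/-- The Laplace–Beltrami operator `Δ = - div ∘ grad` of the round sphere. -/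
def laplaceBeltrami {n : ℕ} (f : Sph n → ℝ) (p : Sph n) : ℝ :=
  - div (grad f) p

/-- `φ` is an eigenfunction of the Laplace–Beltrami operator with eigenvalue `lam`: smooth, not
identically zero, and `Δ φ = lam φ`. -/
structure IsEigenfunction (n : ℕ) (lam : ℝ) (φ : Sph n → ℝ) : Prop where
  smooth : ContMDiff (𝓡 n) 𝓘(ℝ, ℝ) ∞ φ
  ne_zero : φ ≠ 0
  eigen : ∀ p, laplaceBeltrami φ p = lam * φ p

/-- `lam` is an eigenvalue of the Laplace–Beltrami operator of `Sⁿ`. -/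
def IsEigenvalue (n : ℕ) (lam : ℝ) : Prop :=
  ∃ φ : Sph n → ℝ, IsEigenfunction n lam φ

/-- `A` is a nodal domain of `φ`: a connected component of `{φ ≠ 0}`. -/
def IsNodalDomain {n : ℕ} (φ : Sph n → ℝ) (A : Set (Sph n)) : Prop :=
  ∃ x, φ x ≠ 0 ∧ A = connectedComponentIn {y | φ y ≠ 0} x

/-- The open metric ball of radius `R` about `p` for the Riemannian (great circle) distance
of the round sphere, the distance of two points being the angle between them. -/
def geodesicBall {n : ℕ} (p : Sph n) (R : ℝ) : Set (Sph n) :=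
  {x | InnerProductGeometry.angle (p : Ambient n) (x : Ambient n) < R}

/-- The Riemannian volume (surface measure) of the round sphere. -/
def vol (n : ℕ) : Measure (Sph n) :=
  (volume : Measure (Ambient n)).toSphere

end RoundSphere

end

noncomputable section

namespace RoundSphere

/-! ### Euclidean formulas for gradient, divergence and Laplacian on the sphere -/

section

variable {n : ℕ} {F : Type*}

/-! Let `n ≥ 2`. Take the zonal harmonic of degree `k` in the first `n` variables, with axis `x 0`,
and read it as a polynomial in `n + 1` variables. It is still harmonic and homogeneous, so it
restricts to an eigenfunction with eigenvalue `k (k + n - 1)`. Where `x 0 ≠ 0` it equals `x 0 ^ k *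
q t`, where `t` is the sum of the squares of the middle coordinates divided by `x 0 ^ 2`. A positive
root `t` of `q` confines the nodal domain around the half axis `x 0 > 0` to a cone of slope `√t`
(`nodal_subset_sector`). Since the last coordinate does not occur, seen from the pole on the last
axis this cone looks the same at every scale and reaches the pole itself. In a ball of radius `R <
1` about the pole it fills a fraction of order `t ^ ((n - 1) / 2)`, uniformly in `R`
(`vol_sector_div_le`).

What remains is a root `t` of order `k⁻²`, that is, of order `1 / lam`. The profile `q` solves a
singular second-order equation, and positivity of `q` on too long an interval contradicts it
(`exists_nonpos_of_singular_ode`).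

To reach every eigenvalue in this way, `exists_degree_of_isEigenvalue` shows that there are no
others: by symmetry of the Laplacian, a solution for any other number would be orthogonal to all
polynomials, which are dense. If `n = 1` or `lam` is below a threshold depending on `n`, the bound
follows from the trivial estimate that a volume fraction is at most one. -/

theorem coe_sph_ne_zero (p : Sph n) : (p : Ambient n) ≠ 0 := ne_zero_of_mem_unit_sphere p

theorem norm_coe_sph (p : Sph n) : ‖(p : Ambient n)‖ = 1 := mem_sphere_zero_iff_norm.mp p.2

/-- The radial projection of a nonzero vector to the sphere. -/
def proj (x : Ambient n) (hx : x ≠ 0) : Sph n :=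
  ⟨‖x‖⁻¹ • x, by
    rw [mem_sphere_zero_iff_norm, norm_smul, norm_inv, norm_norm,
      inv_mul_cancel₀ (norm_ne_zero_iff.mpr hx)]⟩

theorem coe_proj (x : Ambient n) (hx : x ≠ 0) : (proj x hx : Ambient n) = ‖x‖⁻¹ • x := rfl

theorem radialExt_of_ne_zero [Zero F] (f : Sph n → F) {x : Ambient n} (hx : x ≠ 0) :
    radialExt f x = f (proj x hx) := by
  rw [radialExt, dif_pos hx]; rfl

theorem radialExt_coe [Zero F] (f : Sph n → F) (p : Sph n) : radialExt f p = f p := by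
  rw [radialExt_of_ne_zero f (coe_sph_ne_zero p)]
  congr 1
  ext1
  simp [coe_proj]

theorem radialExt_smul [Zero F] (f : Sph n → F) {c : ℝ} (hc : 0 < c) (x : Ambient n) :
    radialExt f (c • x) = radialExt f x := by
  by_cases hx : x = 0
  · simp [hx]
  rw [radialExt_of_ne_zero f hx, radialExt_of_ne_zero f (smul_ne_zero hc.ne' hx)]
  congr 1
  ext1
  rw [coe_proj, coe_proj, norm_smul, Real.norm_of_nonneg hc.le, smul_smul]
  congr 1
  field_simp

theorem eventually_ne_zero {x : Ambient n} (hx : x ≠ 0) : ∀ᶠ y in nhds x, y ≠ 0 :=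
  isOpen_ne.mem_nhds hx

theorem radialExt_restrict_eventuallyEq [Zero F] (G : Ambient n → F) {x : Ambient n}
    (hx : x ≠ 0) :
    radialExt (fun q : Sph n => G q) =ᶠ[nhds x] fun y => G (‖y‖⁻¹ • y) := by
  filter_upwards [eventually_ne_zero hx] with y hy
  rw [radialExt_of_ne_zero _ hy, coe_proj]

/-- The derivative of the radial projection at a point of the sphere is the tangential
projection. -/
theorem hasFDerivAt_radial_projection (p : Sph n) :
    HasFDerivAt (fun x : Ambient n => ‖x‖⁻¹ • x)
      (ContinuousLinearMap.id ℝ (Ambient n) -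
        (innerSL ℝ (p : Ambient n)).smulRight (p : Ambient n)) (p : Ambient n) := by
  have hp := coe_sph_ne_zero p
  have h1 : HasFDerivAt (fun x : Ambient n => ‖x‖) (innerSL ℝ (p : Ambient n)) (p : Ambient n) := by
    have h := (hasStrictFDerivAt_norm_sq (p : Ambient n)).hasFDerivAt.sqrt (by simp)
    have h2 : (fun x : Ambient n => √(‖x‖ ^ 2)) = fun x => ‖x‖ := by
      funext x; exact Real.sqrt_sq (norm_nonneg x)
    rw [h2] at h
    refine h.congr_fderiv ?_
    rw [norm_coe_sph]
    ext v
    simp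
  have h3 := ((hasDerivAt_inv (norm_ne_zero_iff.mpr hp)).comp_hasFDerivAt (p : Ambient n) h1).smul
    (hasFDerivAt_id (p : Ambient n))
  refine h3.congr_fderiv ?_
  ext1 v
  simp [sub_eq_add_neg]

/-- The composite differs from `L` by the rank-one operator `v ↦ ⟪p, v⟫ • L p`, whose trace is `⟪p,
L p⟫`. -/
theorem trace_comp_tangential (L : Ambient n →L[ℝ] Ambient n) (p : Ambient n) :
    LinearMap.trace ℝ (Ambient n) ((L.comp (ContinuousLinearMap.id ℝ (Ambient n) -
        (innerSL ℝ p).smulRight p) : Ambient n →L[ℝ] Ambient n) :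
        Ambient n →ₗ[ℝ] Ambient n) =
      LinearMap.trace ℝ (Ambient n) (L : Ambient n →ₗ[ℝ] Ambient n) - inner ℝ p (L p) := by
  have : ((L.comp (ContinuousLinearMap.id ℝ (Ambient n) -
        (innerSL ℝ p).smulRight p) : Ambient n →L[ℝ] Ambient n) :
        Ambient n →ₗ[ℝ] Ambient n) = (L : Ambient n →ₗ[ℝ] Ambient n) -
        ((innerSL ℝ p : Ambient n →L[ℝ] ℝ) : Ambient n →ₗ[ℝ] ℝ).smulRight (L p) := by
    ext v
    simp
  rw [this, map_sub, LinearMap.trace_smulRight]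
  simp

theorem coe_smulRight (f : Ambient n →L[ℝ] ℝ) (x : Ambient n) :
    ((f.smulRight x : Ambient n →L[ℝ] Ambient n) : Ambient n →ₗ[ℝ] Ambient n) =
      (f : Ambient n →ₗ[ℝ] ℝ).smulRight x := rfl

/-- The gradient of the restriction of an ambient function is the tangential part of the ambient
gradient. -/
theorem grad_restrict {G : Ambient n → ℝ} {p : Sph n} {N : Ambient n}
    (hG : HasGradientAt G N (p : Ambient n)) :
    grad (fun q : Sph n => G q) p = N - inner ℝ N (p : Ambient n) • (p : Ambient n) := by
  have hp := coe_sph_ne_zero p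
  have hpp : ‖(p : Ambient n)‖⁻¹ • (p : Ambient n) = p := by simp
  have h1 := hG.hasFDerivAt
  rw [← hpp] at h1
  have h2 := (HasFDerivAt.comp (g := G) (f := fun x : Ambient n => ‖x‖⁻¹ • x) (p : Ambient n) h1
    (hasFDerivAt_radial_projection p)).congr_of_eventuallyEq
      (radialExt_restrict_eventuallyEq G hp)
  refine HasGradientAt.gradient ?_
  rw [hasGradientAt_iff_hasFDerivAt]
  refine h2.congr_fderiv ?_
  ext1 v
  simp
  ring

/-- The divergence of the restriction of an ambient vector field. -/
theorem div_restrict {X : Ambient n → Ambient n} {p : Sph n} {L : Ambient n →L[ℝ] Ambient n}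
    (hX : HasFDerivAt X L (p : Ambient n)) :
    div (fun q : Sph n => X q) p =
      LinearMap.trace ℝ (Ambient n) (L : Ambient n →ₗ[ℝ] Ambient n) -
        inner ℝ (p : Ambient n) (L p) := by
  have hp := coe_sph_ne_zero p
  have hpp : ‖(p : Ambient n)‖⁻¹ • (p : Ambient n) = p := by simp
  rw [← hpp] at hX
  have h2 := (HasFDerivAt.comp (g := X) (f := fun x : Ambient n => ‖x‖⁻¹ • x) (p : Ambient n) hX
    (hasFDerivAt_radial_projection p)).congr_of_eventuallyEq
      (radialExt_restrict_eventuallyEq X hp)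
  rw [div, h2.fderiv, trace_comp_tangential]

/-- The Laplace–Beltrami operator on the restriction of an ambient function with gradient field
`N`. -/
theorem laplaceBeltrami_restrict {G : Ambient n → ℝ} {N : Ambient n → Ambient n}
    (hG : ∀ x, HasGradientAt G (N x) x) {p : Sph n} {L : Ambient n →L[ℝ] Ambient n}
    (hN : HasFDerivAt N L (p : Ambient n)) :
    laplaceBeltrami (fun q : Sph n => G q) p =
      inner ℝ (p : Ambient n) (L p) + n * inner ℝ (N p) (p : Ambient n) -
      LinearMap.trace ℝ (Ambient n) (L : Ambient n →ₗ[ℝ] Ambient n) := by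
  have h1 : grad (fun q : Sph n => G q) =
      fun q : Sph n => (fun x => N x - inner ℝ (N x) x • x) (q : Ambient n) := by
    funext q
    exact grad_restrict (hG q)
  have hg : HasFDerivAt (fun x => inner ℝ (N x) x) _ (p : Ambient n) :=
    hN.inner ℝ (hasFDerivAt_id (p : Ambient n))
  have h2 : HasFDerivAt (fun x => N x - inner ℝ (N x) x • x) _ (p : Ambient n) :=
    hN.fun_sub (hg.fun_smul (hasFDerivAt_id (p : Ambient n)))
  rw [laplaceBeltrami, h1, div_restrict h2]
  simp only [ContinuousLinearMap.toLinearMap_sub, ContinuousLinearMap.toLinearMap_add,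
    ContinuousLinearMap.toLinearMap_smul, map_sub, map_add, map_smul,
    coe_smulRight, LinearMap.trace_smulRight]
  simp [inner_sub_right, inner_add_right, inner_smul_right, LinearMap.trace_id]
  ring

end

/-! ### Polynomials and their restrictions to the sphere -/

section

variable {n : ℕ}

/-- Polynomials on the ambient space. -/
abbrev Poly (n : ℕ) : Type := MvPolynomial (Fin (n + 1)) ℝ

/-- The function on the ambient space given by a polynomial. -/
def polyFun (P : Poly n) (x : Ambient n) : ℝ := MvPolynomial.eval (fun i => x i) P

/-- The gradient field of a polynomial. -/
def polyGrad (P : Poly n) (x : Ambient n) : Ambient n :=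
  WithLp.toLp 2 fun i => polyFun (MvPolynomial.pderiv i P) x

/-- The sum of the pure second partial derivatives of a polynomial. -/
def polyLap (P : Poly n) : Poly n := ∑ i, MvPolynomial.pderiv i (MvPolynomial.pderiv i P)

theorem inner_polyGrad (P : Poly n) (x v : Ambient n) :
    inner ℝ (polyGrad P x) v = ∑ i, polyFun (MvPolynomial.pderiv i P) x * v i := by
  simp [polyGrad, PiLp.inner_apply, mul_comm]

theorem hasGradientAt_polyFun (P : Poly n) (x : Ambient n) :
    HasGradientAt (polyFun P) (polyGrad P x) x := by
  rw [hasGradientAt_iff_hasFDerivAt]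
  induction P using MvPolynomial.induction_on with
  | C a =>
    have h : polyFun (MvPolynomial.C a : Poly n) = fun _ => a := by funext y; simp [polyFun]
    rw [h]
    refine (hasFDerivAt_const a x).congr_fderiv ?_
    ext1 v
    simp [inner_polyGrad, polyFun]
  | add P Q hP hQ =>
    have h : polyFun (P + Q) = fun y => polyFun P y + polyFun Q y := by
      funext y; simp [polyFun]
    rw [h]
    refine (hP.fun_add hQ).congr_fderiv ?_
    ext1 v
    simp [inner_polyGrad, polyFun, add_mul, Finset.sum_add_distrib]
  | mul_X P j hP =>
    have h : polyFun (P * MvPolynomial.X j) = fun y => polyFun P y * y j := by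
      funext y; simp [polyFun]
    rw [h]
    have hj : HasFDerivAt (𝕜 := ℝ) (fun y : Ambient n => y j)
        (EuclideanSpace.proj j : Ambient n →L[ℝ] ℝ) x :=
      (EuclideanSpace.proj j : Ambient n →L[ℝ] ℝ).hasFDerivAt
    refine (hP.fun_mul hj).congr_fderiv ?_
    ext1 v
    have key : ∀ i, polyFun (MvPolynomial.pderiv i (P * MvPolynomial.X j)) x * v i =
        (if j = i then polyFun P x * v i else 0) +
          x j * (polyFun (MvPolynomial.pderiv i P) x * v i) := fun i => by
      rw [MvPolynomial.pderiv_mul, MvPolynomial.pderiv_X, Pi.single_apply]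
      split_ifs
      · simp [polyFun]; ring
      · simp [polyFun]; ring
    simp only [add_apply, smul_apply, InnerProductSpace.toDual_apply_apply, inner_polyGrad,
      smul_eq_mul, key, Finset.sum_add_distrib, ← Finset.mul_sum]
    simp

theorem contDiff_polyFun (P : Poly n) : ContDiff ℝ ∞ (polyFun P) := by
  induction P using MvPolynomial.induction_on with
  | C a =>
    have h : polyFun (MvPolynomial.C a : Poly n) = fun _ => a := by funext y; simp [polyFun]
    rw [h]
    exact contDiff_const
  | add P Q hP hQ =>
    have h : polyFun (P + Q) = fun y => polyFun P y + polyFun Q y := by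
      funext y; simp [polyFun]
    rw [h]
    exact hP.add hQ
  | mul_X P j hP =>
    have h : polyFun (P * MvPolynomial.X j) = fun y => polyFun P y * y j := by
      funext y; simp [polyFun]
    rw [h]
    exact hP.mul (EuclideanSpace.proj j : Ambient n →L[ℝ] ℝ).contDiff

theorem contMDiff_polyFun (P : Poly n) :
    ContMDiff (𝓡 n) 𝓘(ℝ, ℝ) ∞ fun p : Sph n => polyFun P p :=
  (contDiff_polyFun P).contMDiff.comp contMDiff_coe_sphere

/-- The derivative of the gradient field of a polynomial. -/
def polyHess (P : Poly n) (x : Ambient n) : Ambient n →L[ℝ] Ambient n :=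
  (PiLp.continuousLinearEquiv 2 ℝ fun _ : Fin (n + 1) => ℝ).symm.toContinuousLinearMap.comp
    (ContinuousLinearMap.pi fun i => innerSL ℝ (polyGrad (MvPolynomial.pderiv i P) x))

theorem polyHess_apply (P : Poly n) (x v : Ambient n) (i : Fin (n + 1)) :
    polyHess P x v i = inner ℝ (polyGrad (MvPolynomial.pderiv i P) x) v := by
  simp [polyHess]

theorem hasFDerivAt_polyGrad (P : Poly n) (x : Ambient n) :
    HasFDerivAt (polyGrad P) (polyHess P x) x := by
  have h : HasFDerivAt (fun y => fun i => polyFun (MvPolynomial.pderiv i P) y)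
      (ContinuousLinearMap.pi fun i => innerSL ℝ (polyGrad (MvPolynomial.pderiv i P) x)) x :=
    hasFDerivAt_pi.mpr fun i => (hasGradientAt_polyFun (MvPolynomial.pderiv i P) x).hasFDerivAt
  exact (PiLp.continuousLinearEquiv 2 ℝ fun _ : Fin (n + 1) => ℝ).symm.hasFDerivAt.comp x h

theorem trace_polyHess (P : Poly n) (x : Ambient n) :
    LinearMap.trace ℝ (Ambient n) (polyHess P x : Ambient n →ₗ[ℝ] Ambient n) =
      polyFun (polyLap P) x := by
  rw [LinearMap.trace_eq_sum_inner _ (EuclideanSpace.basisFun (Fin (n + 1)) ℝ)]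
  simp [EuclideanSpace.inner_single_left, polyHess_apply, inner_polyGrad, polyLap, polyFun]

/-- Euler's identity. Applied to `P` and to its partial derivatives, it evaluates the radial terms
of the Laplacian. -/
theorem sum_polyFun_pderiv_mul {P : Poly n} {k : ℕ} (hP : P.IsHomogeneous k) (x : Ambient n) :
    ∑ i, polyFun (MvPolynomial.pderiv i P) x * x i = k * polyFun P x := by
  have h := congrArg (fun Q => polyFun Q x) hP.sum_X_mul_pderiv
  simp only [polyFun, map_sum, map_mul, MvPolynomial.eval_X, map_natCast, nsmul_eq_mul] at h ⊢
  rw [← h]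
  exact Finset.sum_congr rfl fun i _ => mul_comm _ _

/-- The Laplace–Beltrami operator on the restriction of a homogeneous polynomial. -/
theorem laplaceBeltrami_polyFun {P : Poly n} {k : ℕ} (hP : P.IsHomogeneous k) (p : Sph n) :
    laplaceBeltrami (fun q : Sph n => polyFun P q) p =
      k * (k + n - 1) * polyFun P p - polyFun (polyLap P) p := by
  rw [laplaceBeltrami_restrict (hasGradientAt_polyFun P) (hasFDerivAt_polyGrad P p),
    trace_polyHess, inner_polyGrad, sum_polyFun_pderiv_mul hP]
  have h : inner ℝ (p : Ambient n) (polyHess P p p) = (k - 1) * (k * polyFun P p) := by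
    rw [← sum_polyFun_pderiv_mul hP, Finset.mul_sum, PiLp.inner_apply]
    refine Finset.sum_congr rfl fun i _ => ?_
    rw [polyHess_apply, inner_polyGrad, sum_polyFun_pderiv_mul hP.pderiv]
    -- In degree zero the truncated `k - 1` is not the true degree of the derivative, but there the
    -- derivative vanishes.
    rcases k with _ | k
    · have : MvPolynomial.pderiv i P = 0 := by
        rw [← MvPolynomial.totalDegree_zero_iff_isHomogeneous] at hP
        rw [MvPolynomial.totalDegree_eq_zero_iff_eq_C] at hP
        rw [hP]; simp
      simp [this, polyFun]
    · simp
      ring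
  rw [h]
  ring

theorem isHomogeneous_polyLap {P : Poly n} {k : ℕ} (hP : P.IsHomogeneous k) :
    (polyLap P).IsHomogeneous (k - 2) :=
  MvPolynomial.IsHomogeneous.sum _ _ _ fun _ _ => hP.pderiv.pderiv

/-- Covers the degrees in which `k - 2` truncates; these start the induction on the degree in the
orthogonality argument. -/
theorem polyLap_eq_zero {P : Poly n} {k : ℕ} (hP : P.IsHomogeneous k) (hk : k < 2) :
    polyLap P = 0 := by
  refine Finset.sum_eq_zero fun i _ => ?_
  have h : (MvPolynomial.pderiv i P).IsHomogeneous 0 := by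
    have := hP.pderiv (i := i)
    rwa [show k - 1 = 0 by omega] at this
  rw [← MvPolynomial.totalDegree_zero_iff_isHomogeneous,
    MvPolynomial.totalDegree_eq_zero_iff_eq_C] at h
  rw [h]; simp

end

/-! ### Smoothness of radial extensions and the Euclidean divergence theorem -/

section

variable {n : ℕ}

theorem contDiffAt_norm_inv_smul {x : Ambient n} (hx : x ≠ 0) :
    ContDiffAt ℝ ∞ (fun y : Ambient n => ‖y‖⁻¹ • y) x :=
  ((contDiffAt_norm ℝ hx).inv (norm_ne_zero_iff.mpr hx)).smul contDiffAt_id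

/-- The radial extension of a smooth function is smooth away from the origin. -/
theorem contDiffAt_radialExt {f : Sph n → ℝ} (hf : ContMDiff (𝓡 n) 𝓘(ℝ, ℝ) ∞ f)
    {x : Ambient n} (hx : x ≠ 0) : ContDiffAt ℝ ∞ (radialExt f) x := by
  let U : TopologicalSpace.Opens (Ambient n) := ⟨{0}ᶜ, isOpen_compl_singleton⟩
  have hg : ContMDiff 𝓘(ℝ, Ambient n) 𝓘(ℝ, Ambient n) ∞
      (fun y : U => ‖(y : Ambient n)‖⁻¹ • (y : Ambient n)) := fun y =>
    contMDiffAt_subtype_iff.mpr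
      (contDiffAt_norm_inv_smul (x := (y : Ambient n)) y.2).contMDiffAt
  have h2 := hf.comp (hg.codRestrict_sphere (n := n) fun y => (proj (y : Ambient n) y.2).2)
  have h3 : ContMDiffAt 𝓘(ℝ, Ambient n) 𝓘(ℝ, ℝ) ∞ (fun y : U => radialExt f (y : Ambient n))
      ⟨x, hx⟩ := by
    convert h2 ⟨x, hx⟩ using 1
    funext y
    exact radialExt_of_ne_zero f y.2
  exact (contMDiffAt_subtype_iff.mp h3).contDiffAt

/-- The derivative of a radial extension scales with degree `-1`. -/
theorem fderiv_radialExt_smul {F : Type*} [NormedAddCommGroup F] [NormedSpace ℝ F]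
    (f : Sph n → F) {c : ℝ} (hc : 0 < c) (x : Ambient n) :
    fderiv ℝ (radialExt f) x = c • fderiv ℝ (radialExt f) (c • x) := by
  have h : radialExt f = fun y => radialExt f (c • y) := by
    funext y; rw [radialExt_smul f hc]
  conv_lhs => rw [h]
  rw [fderiv_comp_smul]

/-- The extension is constant along the ray through `x`, so its radial derivative vanishes. This
makes spherical gradients tangent. -/
theorem fderiv_radialExt_self {F : Type*} [NormedAddCommGroup F] [NormedSpace ℝ F]
    {f : Sph n → F} {x : Ambient n} (hf : DifferentiableAt ℝ (radialExt f) x) :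
    fderiv ℝ (radialExt f) x x = 0 := by
  have h1 : HasDerivAt (fun t : ℝ => t • x) x 1 := by
    simpa using (hasDerivAt_id (1 : ℝ)).smul_const x
  have h2 : HasFDerivAt (radialExt f) (fderiv ℝ (radialExt f) x) ((1 : ℝ) • x) := by
    simpa using hf.hasFDerivAt
  have h3 := h2.comp_hasDerivAt (1 : ℝ) h1
  have h4 : (radialExt f ∘ fun t : ℝ => t • x) =ᶠ[nhds 1] fun _ => radialExt f x := by
    filter_upwards [lt_mem_nhds (show (0 : ℝ) < 1 by norm_num)] with t ht
    exact radialExt_smul f ht x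
  exact (h3.congr_of_eventuallyEq h4.symm).unique (hasDerivAt_const _ _)

theorem inner_grad_self {f : Sph n → ℝ} (hf : ContMDiff (𝓡 n) 𝓘(ℝ, ℝ) ∞ f) (p : Sph n) :
    inner ℝ (p : Ambient n) (grad f p) = 0 := by
  have h := (contDiffAt_radialExt hf (coe_sph_ne_zero p)).differentiableAt (by simp)
  rw [real_inner_comm, grad, ← InnerProductSpace.toDual_apply_apply (𝕜 := ℝ), gradient,
    LinearIsometryEquiv.apply_symm_apply]
  exact fderiv_radialExt_self h

theorem contDiffAt_radialExt_grad {f : Sph n → ℝ} (hf : ContMDiff (𝓡 n) 𝓘(ℝ, ℝ) ∞ f)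
    {x : Ambient n} (hx : x ≠ 0) : ContDiffAt ℝ ∞ (radialExt (grad f)) x := by
  have h1 : ContDiffAt ℝ ∞ (gradient (radialExt f)) (‖x‖⁻¹ • x) := by
    have hD := (InnerProductSpace.toDual ℝ (Ambient n)).symm.toContinuousLinearEquiv.contDiff
      (n := ∞)
    refine hD.contDiffAt.comp _ ?_
    exact (contDiffAt_radialExt hf (smul_ne_zero (by simpa using hx) hx)).fderiv_right
      (m := ∞) (by simp)
  have h2 := ContDiffAt.comp (f := fun y : Ambient n => ‖y‖⁻¹ • y) x h1
    (contDiffAt_norm_inv_smul hx)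
  exact h2.congr_of_eventuallyEq
    (radialExt_restrict_eventuallyEq (gradient (radialExt f)) hx)

/-- The divergence theorem for compactly supported fields on the ambient space. -/
theorem integral_trace_fderiv_eq_zero {V : Ambient n → Ambient n} (hV : ContDiff ℝ 1 V)
    (hc : HasCompactSupport V) :
    ∫ x, LinearMap.trace ℝ (Ambient n) (fderiv ℝ V x : Ambient n →ₗ[ℝ] Ambient n) = 0 := by
  let e := EuclideanSpace.basisFun (Fin (n + 1)) ℝ
  have hcont : Continuous (fderiv ℝ V) := hV.continuous_fderiv (by simp)
  have hcs : HasCompactSupport (fderiv ℝ V) := hc.fderiv ℝ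
  have hint : ∀ i, Integrable (fun x => inner ℝ (e i) (fderiv ℝ V x (e i))) := fun i => by
    refine Continuous.integrable_of_hasCompactSupport (by fun_prop) ?_
    exact hcs.comp_left (g := fun L : Ambient n →L[ℝ] Ambient n => inner ℝ (e i) (L (e i)))
      (by simp)
  have h0 : ∀ i, ∫ x, inner ℝ (e i) (fderiv ℝ V x (e i)) = 0 := fun i => by
    have hd : ∀ x, fderiv ℝ (fun y => inner ℝ (e i) (V y)) x (e i) =
        inner ℝ (e i) (fderiv ℝ V x (e i)) := fun x => by
      have := ((innerSL ℝ (e i)).hasFDerivAt.comp x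
        (hV.differentiable (by simp) x).hasFDerivAt).fderiv
      rw [show (fun y => inner ℝ (e i) (V y)) = innerSL ℝ (e i) ∘ V from rfl, this]
      rfl
    have hVi : Integrable (fun x => inner ℝ (e i) (V x)) := by
      have := hV.continuous
      refine Continuous.integrable_of_hasCompactSupport (by fun_prop) ?_
      exact hc.comp_left (g := fun L : Ambient n => inner ℝ (e i) L) (by simp)
    -- Integration by parts against the constant `1`, in each coordinate direction.
    have := integral_mul_fderiv_eq_neg_fderiv_mul_of_integrable (μ := (volume : Measure (Ambient n)))
      (f := fun _ => (1 : ℝ)) (g := fun y => inner ℝ (e i) (V y)) (v := e i)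
      (by simp) (by simpa [hd] using hint i) (by simpa using hVi) (by fun_prop)
      (fun x _ => (innerSL ℝ (e i)).differentiableAt.comp x (hV.differentiable (by simp) x))
    simpa [hd] using this
  simp_rw [LinearMap.trace_eq_sum_inner _ e]
  exact (integral_finsetSum _ fun i _ => hint i).trans (Finset.sum_eq_zero fun i _ => h0 i)

end

/-! ### Integration over the sphere and symmetry of the Laplacian -/

section

variable {n : ℕ}

/-- A smooth bump on the real line centred at `1` and supported away from `0`. -/
def bumpOne : ContDiffBump (1 : ℝ) := ⟨1 / 4, 1 / 2, by norm_num, by norm_num⟩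

/-- A smooth radial cutoff supported in an annulus around the unit sphere. -/
def cutoff (x : Ambient n) : ℝ := bumpOne (‖x‖ ^ 2)

theorem contDiff_cutoff : ContDiff ℝ ∞ (cutoff (n := n)) :=
  bumpOne.contDiff.comp (contDiff_norm_sq ℝ)

theorem cutoff_nonneg (x : Ambient n) : 0 ≤ cutoff x := bumpOne.nonneg

theorem cutoff_coe (p : Sph n) : cutoff (p : Ambient n) = 1 := by
  rw [cutoff, norm_coe_sph, one_pow]
  exact bumpOne.one_of_mem_closedBall (mem_closedBall_self bumpOne.rIn_pos.le)

theorem cutoff_eventually_eq_zero : ∀ᶠ x in nhds (0 : Ambient n), cutoff x = 0 := by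
  have h : ∀ᶠ x in nhds (0 : Ambient n), ‖x‖ ^ 2 < 1 / 2 :=
    (continuous_norm.pow 2).continuousAt.eventually_lt continuousAt_const (by norm_num)
  filter_upwards [h] with x hx
  refine bumpOne.zero_of_le_dist ?_
  rw [Real.dist_eq, abs_sub_comm]
  refine le_trans ?_ (le_abs_self _)
  change (1 / 2 : ℝ) ≤ _
  linarith

theorem hasCompactSupport_cutoff : HasCompactSupport (cutoff (n := n)) := by
  refine HasCompactSupport.intro (isCompact_closedBall (0 : Ambient n) 2) fun x hx => ?_
  refine bumpOne.zero_of_le_dist ?_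
  rw [mem_closedBall_zero_iff, not_le] at hx
  rw [Real.dist_eq]
  refine le_trans ?_ (le_abs_self _)
  change (1 / 2 : ℝ) ≤ _
  nlinarith

theorem fderiv_cutoff_apply (x v : Ambient n) :
    fderiv ℝ cutoff x v = deriv bumpOne (‖x‖ ^ 2) * (2 * inner ℝ x v) := by
  have h1 : HasDerivAt bumpOne (deriv bumpOne (‖x‖ ^ 2)) (‖x‖ ^ 2) :=
    ((bumpOne.contDiff (n := 1)).differentiable (by simp) _).hasDerivAt
  have h2 := h1.comp_hasFDerivAt x (hasStrictFDerivAt_norm_sq x).hasFDerivAt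
  rw [show cutoff = (bumpOne : ℝ → ℝ) ∘ fun y : Ambient n => ‖y‖ ^ 2 from rfl, h2.fderiv]
  simp

/-- The weight with which functions on the sphere are integrated over the ambient space. -/
def weight (x : Ambient n) : ℝ := cutoff x * ‖x‖⁻¹

theorem weight_nonneg (x : Ambient n) : 0 ≤ weight x :=
  mul_nonneg (cutoff_nonneg x) (by positivity)

theorem continuousAt_radialExt {f : Sph n → ℝ} (hf : Continuous f) {x : Ambient n} (hx : x ≠ 0) :
    ContinuousAt (radialExt f) x := by
  have h : ContinuousOn (radialExt f) {0}ᶜ := by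
    rw [continuousOn_iff_continuous_domRestrict]
    have h1 : ({0}ᶜ : Set (Ambient n)).domRestrict (radialExt f) = fun y => f (proj y.1 y.2) := by
      funext y
      exact radialExt_of_ne_zero f y.2
    rw [h1]
    refine hf.comp (Continuous.subtype_mk ?_ _)
    exact (Continuous.inv₀ (by fun_prop) fun y => norm_ne_zero_iff.mpr y.2).smul
      continuous_subtype_val
  exact h.continuousAt (isOpen_compl_singleton.mem_nhds hx)

theorem continuous_weight_mul {f : Sph n → ℝ} (hf : Continuous f) :
    Continuous fun x => weight x * radialExt f x := by
  rw [continuous_iff_continuousAt]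
  intro x
  by_cases hx : x = 0
  · subst hx
    refine (continuousAt_const (y := (0 : ℝ))).congr ?_
    filter_upwards [cutoff_eventually_eq_zero (n := n)] with y hy
    simp [weight, hy]
  · exact (contDiff_cutoff.continuous.continuousAt.mul
      (continuous_norm.continuousAt.inv₀ (norm_ne_zero_iff.mpr hx))).mul
      (continuousAt_radialExt hf hx)

theorem integrable_weight_mul {f : Sph n → ℝ} (hf : Continuous f) :
    Integrable fun x => weight x * radialExt f x :=
  (continuous_weight_mul hf).integrable_of_hasCompactSupport
    (hasCompactSupport_cutoff.mul_right.mul_right)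

/-- A positive multiple of the integral over the sphere. -/
def sphInt (f : Sph n → ℝ) : ℝ := ∫ x, weight x * radialExt f x

theorem radialExt_apply₂ {F G H : Type*} [Zero F] [Zero G] [Zero H] (g : F → G → H) (hg : g 0 0 = 0)
    (a : Sph n → F) (b : Sph n → G) (x : Ambient n) :
    radialExt (fun p => g (a p) (b p)) x = g (radialExt a x) (radialExt b x) := by
  by_cases hx : x = 0
  · simp [radialExt, hx, hg]
  · simp [radialExt_of_ne_zero _ hx]

theorem sphInt_add {f g : Sph n → ℝ} (hf : Continuous f) (hg : Continuous g) :
    sphInt (fun p => f p + g p) = sphInt f + sphInt g := by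
  rw [sphInt, sphInt, sphInt,
    ← integral_add (integrable_weight_mul hf) (integrable_weight_mul hg)]
  congr 1
  funext x
  rw [radialExt_apply₂ (fun a b : ℝ => a + b) (by simp), mul_add]

theorem sphInt_const_mul (c : ℝ) (f : Sph n → ℝ) :
    sphInt (fun p => c * f p) = c * sphInt f := by
  rw [sphInt, sphInt, ← integral_const_mul]
  congr 1
  funext x
  rw [radialExt_apply₂ (fun a _ : ℝ => c * a) (by simp) f f]
  ring

theorem sphInt_mono {f g : Sph n → ℝ} (hf : Continuous f) (hg : Continuous g)
    (h : ∀ p, f p ≤ g p) : sphInt f ≤ sphInt g := by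
  refine integral_mono (integrable_weight_mul hf) (integrable_weight_mul hg) fun x => ?_
  refine mul_le_mul_of_nonneg_left ?_ (weight_nonneg x)
  by_cases hx : x = 0
  · simp [radialExt, hx]
  · simpa [radialExt_of_ne_zero _ hx] using h _

theorem eq_zero_of_sphInt_eq_zero {f : Sph n → ℝ} (hf : Continuous f) (h0 : ∀ p, 0 ≤ f p)
    (h : sphInt f = 0) (p : Sph n) : f p = 0 := by
  have hnn : ∀ x, 0 ≤ weight x * radialExt f x := fun x => by
    refine mul_nonneg (weight_nonneg x) ?_
    by_cases hx : x = 0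
    · simp [radialExt, hx]
    · simpa [radialExt_of_ne_zero _ hx] using h0 _
  have h1 := (integral_eq_zero_iff_of_nonneg hnn (integrable_weight_mul hf)).mp h
  have h2 := congrFun ((continuous_weight_mul hf).ae_eq_iff_eq volume continuous_zero |>.mp h1)
    (p : Ambient n)
  simpa [weight, cutoff_coe, radialExt_coe, norm_coe_sph] using h2

/-- The divergence theorem on the sphere. -/
theorem sphInt_div_eq_zero {X : Sph n → Ambient n}
    (hX : ∀ x : Ambient n, x ≠ 0 → ContDiffAt ℝ 1 (radialExt X) x)
    (ht : ∀ p : Sph n, inner ℝ (p : Ambient n) (X p) = 0) : sphInt (div X) = 0 := by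
  have hV : ContDiff ℝ 1 fun x => cutoff x • radialExt X x := by
    rw [contDiff_iff_contDiffAt]
    intro x
    by_cases hx : x = 0
    · subst hx
      refine (contDiffAt_const (c := (0 : Ambient n))).congr_of_eventuallyEq ?_
      filter_upwards [cutoff_eventually_eq_zero (n := n)] with y hy
      simp [hy]
    · exact (contDiff_cutoff.of_le (by simp)).contDiffAt.smul (hX x hx)
  have h := integral_trace_fderiv_eq_zero hV (hasCompactSupport_cutoff.smul_right)
  rw [← h, sphInt]
  congr 1
  funext x
  by_cases hx : x = 0
  · subst hx
    have : (fun x => cutoff x • radialExt X x) =ᶠ[nhds 0] fun _ => 0 := by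
      filter_upwards [cutoff_eventually_eq_zero (n := n)] with y hy
      simp [hy]
    rw [this.fderiv_eq]
    simp [radialExt]
  · have hc : DifferentiableAt ℝ cutoff x := contDiff_cutoff.differentiable (by simp) x
    rw [(hc.hasFDerivAt.fun_smul ((hX x hx).differentiableAt (by simp)).hasFDerivAt).fderiv]
    -- The cutoff has radial gradient and the field is tangent, so the term with the derivative of
    -- the cutoff drops out.
    have ht' : inner ℝ x (radialExt X x) = 0 := by
      have := ht (proj x hx)
      rw [coe_proj, inner_smul_left, ← radialExt_of_ne_zero X hx] at this
      simpa [hx] using this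
    -- Derivatives of radial extensions have degree `-1`; this is why `weight` carries the factor
    -- `‖x‖⁻¹`.
    have htr : radialExt (div X) x * ‖x‖⁻¹ = LinearMap.trace ℝ (Ambient n)
        (fderiv ℝ (radialExt X) x : Ambient n →ₗ[ℝ] Ambient n) := by
      rw [fderiv_radialExt_smul X (c := ‖x‖⁻¹) (by positivity), radialExt_of_ne_zero _ hx, div,
        coe_proj, ContinuousLinearMap.toLinearMap_smul, map_smul, smul_eq_mul, mul_comm]
    rw [ContinuousLinearMap.toLinearMap_add, map_add, coe_smulRight, LinearMap.trace_smulRight,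
      ContinuousLinearMap.toLinearMap_smul, map_smul, ← htr]
    simp [fderiv_cutoff_apply, ht', weight]
    ring

theorem div_smul_field {f : Sph n → ℝ} {Y : Sph n → Ambient n} {p : Sph n}
    (hf : DifferentiableAt ℝ (radialExt f) (p : Ambient n))
    (hY : DifferentiableAt ℝ (radialExt Y) (p : Ambient n)) :
    div (fun q => f q • Y q) p = f p * div Y p + inner ℝ (grad f p) (Y p) := by
  have h : radialExt (fun q => f q • Y q) = fun x => radialExt f x • radialExt Y x := by
    funext x
    exact radialExt_apply₂ (fun (a : ℝ) (b : Ambient n) => a • b) (by simp) f Y x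
  rw [div, h, (hf.hasFDerivAt.fun_smul hY.hasFDerivAt).fderiv,
    ContinuousLinearMap.toLinearMap_add, map_add, coe_smulRight, LinearMap.trace_smulRight,
    ContinuousLinearMap.toLinearMap_smul, map_smul, radialExt_coe, radialExt_coe, div, grad,
    ← InnerProductSpace.toDual_apply_apply (𝕜 := ℝ), gradient,
    LinearIsometryEquiv.apply_symm_apply]
  simp

theorem radialExt_smul_grad_contDiffAt {f g : Sph n → ℝ} (hf : ContMDiff (𝓡 n) 𝓘(ℝ, ℝ) ∞ f)
    (hg : ContMDiff (𝓡 n) 𝓘(ℝ, ℝ) ∞ g) {x : Ambient n} (hx : x ≠ 0) :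
    ContDiffAt ℝ ∞ (radialExt fun q => f q • grad g q) x := by
  have h : radialExt (fun q => f q • grad g q) = fun x => radialExt f x • radialExt (grad g) x := by
    funext x
    exact radialExt_apply₂ (fun (a : ℝ) (b : Ambient n) => a • b) (by simp) f (grad g) x
  rw [h]
  exact (contDiffAt_radialExt hf hx).smul (contDiffAt_radialExt_grad hg hx)

/-- The Laplace–Beltrami operator is symmetric. -/
theorem sphInt_laplaceBeltrami_symm {f g : Sph n → ℝ} (hf : ContMDiff (𝓡 n) 𝓘(ℝ, ℝ) ∞ f)
    (hg : ContMDiff (𝓡 n) 𝓘(ℝ, ℝ) ∞ g) :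
    sphInt (fun p => f p * laplaceBeltrami g p - g p * laplaceBeltrami f p) = 0 := by
  have hfd : ∀ {f : Sph n → ℝ}, ContMDiff (𝓡 n) 𝓘(ℝ, ℝ) ∞ f → ∀ p : Sph n,
      DifferentiableAt ℝ (radialExt f) (p : Ambient n) := fun hf p =>
    (contDiffAt_radialExt hf (coe_sph_ne_zero p)).differentiableAt (by simp)
  have hgd : ∀ {f : Sph n → ℝ}, ContMDiff (𝓡 n) 𝓘(ℝ, ℝ) ∞ f → ∀ p : Sph n,
      DifferentiableAt ℝ (radialExt (grad f)) (p : Ambient n) := fun hf p =>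
    (contDiffAt_radialExt_grad hf (coe_sph_ne_zero p)).differentiableAt (by simp)
  have hX : radialExt (fun q => g q • grad f q - f q • grad g q) = fun x =>
      radialExt (fun q => g q • grad f q) x - radialExt (fun q => f q • grad g q) x := by
    funext x
    exact radialExt_apply₂ (fun (a b : Ambient n) => a - b) (by simp) _ _ x
  -- Green's identity: the divergence of `g ∇f - f ∇g` is `f Δg - g Δf`, the product terms in the
  -- two gradients cancelling.
  have h := sphInt_div_eq_zero (X := fun q => g q • grad f q - f q • grad g q)
    (fun x hx => by
      rw [hX]
      exact ((radialExt_smul_grad_contDiffAt hg hf hx).sub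
        (radialExt_smul_grad_contDiffAt hf hg hx)).of_le (by simp))
    (fun p => by
      rw [inner_sub_right, inner_smul_right, inner_smul_right, inner_grad_self hf,
        inner_grad_self hg]
      simp)
  rw [← h]
  congr 1
  funext p
  have hp := coe_sph_ne_zero p
  have hsub : div (fun q => g q • grad f q - f q • grad g q) p =
      div (fun q => g q • grad f q) p - div (fun q => f q • grad g q) p := by
    have h1 := (radialExt_smul_grad_contDiffAt hg hf hp).differentiableAt (by simp)
    have h2 := (radialExt_smul_grad_contDiffAt hf hg hp).differentiableAt (by simp)
    rw [div, hX, (h1.hasFDerivAt.fun_sub h2.hasFDerivAt).fderiv,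
      ContinuousLinearMap.toLinearMap_sub, map_sub, div, div]
  rw [hsub, div_smul_field (hfd hg p) (hgd hf p), div_smul_field (hfd hf p) (hgd hg p),
    laplaceBeltrami, laplaceBeltrami, real_inner_comm]
  ring

end

/-! ### The spectrum of the round sphere -/

section

variable {n : ℕ}

theorem continuous_polyFun_sph (P : Poly n) : Continuous fun p : Sph n => polyFun P p :=
  (contDiff_polyFun P).continuous.comp continuous_subtype_val

/-- Polynomials are uniformly dense in the continuous functions on the sphere. -/
theorem exists_poly_near {f : Sph n → ℝ} (hf : Continuous f) {ε : ℝ} (hε : 0 < ε) :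
    ∃ P : Poly n, ∀ p : Sph n, |f p - polyFun P p| < ε := by
  let c : Fin (n + 1) → C(Sph n, ℝ) := fun i => ⟨fun p => (p : Ambient n) i, by fun_prop⟩
  let Φ : Poly n →ₐ[ℝ] C(Sph n, ℝ) := MvPolynomial.aeval c
  have hΦ : ∀ (P : Poly n) (p : Sph n), Φ P p = polyFun P p := fun P p => by
    induction P using MvPolynomial.induction_on with
    | C a => simp [Φ, polyFun]
    | add P Q hP hQ => rw [map_add, ContinuousMap.add_apply, hP, hQ]; simp [polyFun]
    | mul_X P i hP =>
      rw [map_mul, ContinuousMap.mul_apply, hP]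
      simp [polyFun, Φ, c]
  have hsep : Φ.range.SeparatesPoints := fun p q hpq => by
    have : ∃ i, (p : Ambient n) i ≠ (q : Ambient n) i := by
      by_contra! h
      exact hpq (Subtype.ext (PiLp.ext h))
    obtain ⟨i, hi⟩ := this
    refine ⟨Φ (MvPolynomial.X i), ⟨_, ⟨_, rfl⟩, rfl⟩, ?_⟩
    simpa [hΦ, polyFun] using hi
  obtain ⟨g, hg⟩ := ContinuousMap.exists_mem_subalgebra_near_continuous_of_separatesPoints
    Φ.range hsep f hf ε hε
  obtain ⟨⟨_, ⟨P, rfl⟩⟩, hP⟩ : ∃ g : Φ.range, ∀ x, ‖(g : C(Sph n, ℝ)) x - f x‖ < ε := ⟨g, hg⟩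
  refine ⟨P, fun p => ?_⟩
  rw [abs_sub_comm, ← hΦ]
  exact hP p

/-- A smooth solution of the eigenvalue equation for a number that is not of the form
`k (k + n - 1)` is orthogonal to all polynomials. -/
theorem sphInt_mul_polyFun_eq_zero {lam : ℝ} {φ : Sph n → ℝ}
    (hφ : ContMDiff (𝓡 n) 𝓘(ℝ, ℝ) ∞ φ) (he : ∀ p, laplaceBeltrami φ p = lam * φ p)
    (hlam : ∀ k : ℕ, lam ≠ k * (k + n - 1)) (P : Poly n) :
    sphInt (fun p => φ p * polyFun P p) = 0 := by
  have hc : ∀ Q : Poly n, Continuous fun p : Sph n => φ p * polyFun Q p := fun Q =>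
    hφ.continuous.mul (continuous_polyFun_sph Q)
  have hom : ∀ (k : ℕ) (Q : Poly n), Q.IsHomogeneous k →
      sphInt (fun p => φ p * polyFun Q p) = 0 := by
    intro k
    induction k using Nat.strong_induction_on with
    | _ k ih =>
      intro Q hQ
      have h0 : sphInt (fun p => φ p * polyFun (polyLap Q) p) = 0 := by
        by_cases hk : k < 2
        · simpa [polyLap_eq_zero hQ hk, polyFun] using sphInt_const_mul 0 φ
        · exact ih (k - 2) (by omega) _ (isHomogeneous_polyLap hQ)
      -- Symmetry gives `(k (k + n - 1) - lam) ∫ φ Q = ∫ φ (polyLap Q)`. The right side vanishes by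
      -- induction, and the factor on the left is nonzero.
      have h1 := sphInt_laplaceBeltrami_symm hφ (contMDiff_polyFun Q)
      have h2 : (fun p : Sph n => φ p * laplaceBeltrami (fun q : Sph n => polyFun Q q) p -
          polyFun Q p * laplaceBeltrami φ p) = fun p =>
          (k * (k + n - 1) - lam) * (φ p * polyFun Q p) +
            (-1) * (φ p * polyFun (polyLap Q) p) := by
        funext p
        rw [laplaceBeltrami_polyFun hQ, he]
        ring
      rw [h2, sphInt_add ((hc Q).const_mul _) ((hc _).const_mul _), sphInt_const_mul,
        sphInt_const_mul, h0, mul_zero, add_zero] at h1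
      exact (mul_eq_zero.mp h1).resolve_left fun h => hlam k (by linarith)
  induction P using MvPolynomial.induction_on' with
  | monomial m a => exact hom _ _ (MvPolynomial.isHomogeneous_monomial a rfl)
  | add P Q hP hQ =>
    have : (fun p : Sph n => φ p * polyFun (P + Q) p) =
        fun p : Sph n => φ p * polyFun P p + φ p * polyFun Q p := by
      funext p
      simp [polyFun, mul_add]
    rw [this, sphInt_add (hc P) (hc Q), hP, hQ, add_zero]

/-- Every eigenvalue of the round sphere is of the form `k (k + n - 1)`. -/
theorem exists_degree_of_isEigenvalue {lam : ℝ} (h : IsEigenvalue n lam) :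
    ∃ k : ℕ, lam = k * (k + n - 1) := by
  obtain ⟨φ, hφ, hne, he⟩ := h
  by_contra! hlam
  have horth := sphInt_mul_polyFun_eq_zero hφ he hlam
  have hφc := hφ.continuous
  -- Orthogonality allows one factor `φ` to be replaced by its uniformly small distance to a
  -- polynomial.
  have hle : ∀ ε > 0, sphInt (fun p => φ p * φ p) ≤ ε * sphInt (fun p => |φ p|) := by
    intro ε hε
    obtain ⟨P, hP⟩ := exists_poly_near hφc hε
    have hPc := continuous_polyFun_sph P
    have h1 : sphInt (fun p => φ p * φ p) = sphInt (fun p => φ p * (φ p - polyFun P p)) := by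
      have h2 : (fun p : Sph n => φ p * φ p) =
          fun p => φ p * (φ p - polyFun P p) + φ p * polyFun P p := by
        funext p; ring
      rw [h2, sphInt_add (by fun_prop) (by fun_prop), horth P, add_zero]
    rw [h1, ← sphInt_const_mul]
    refine sphInt_mono (by fun_prop) (by fun_prop) fun p => ?_
    calc φ p * (φ p - polyFun P p) ≤ |φ p * (φ p - polyFun P p)| := le_abs_self _
      _ = |φ p - polyFun P p| * |φ p| := by rw [abs_mul, mul_comm]
      _ ≤ ε * |φ p| := mul_le_mul_of_nonneg_right (hP p).le (abs_nonneg _)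
  have hnn : ∀ p, 0 ≤ φ p * φ p := fun p => mul_self_nonneg _
  have hzero : sphInt (fun p => φ p * φ p) = 0 := by
    refine le_antisymm ?_ ?_
    · refine ge_of_tendsto' (x := Filter.atTop) (f := fun k : ℕ =>
        (1 / ((k : ℝ) + 1)) * sphInt (fun p => |φ p|)) ?_ fun k => hle _ (by positivity)
      simpa using tendsto_one_div_add_atTop_nhds_zero_nat.mul_const (sphInt fun p => |φ p|)
    · have := sphInt_mono (f := fun _ => 0) (by fun_prop) (by fun_prop) hnn
      simpa [sphInt, radialExt] using this
  refine hne (funext fun p => ?_)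
  simpa using eq_zero_of_sphInt_eq_zero (by fun_prop) hnn hzero p

end

/-! ### The profile of the zonal harmonic and its first root -/

section

theorem antitoneOn_Icc_of_hasDerivAt {f f' : ℝ → ℝ} {a b : ℝ} (hf : ∀ t, HasDerivAt f (f' t) t)
    (h : ∀ t ∈ Set.Icc a b, f' t ≤ 0) : AntitoneOn f (Set.Icc a b) := by
  refine antitoneOn_of_deriv_nonpos (convex_Icc a b) (fun t _ => (hf t).continuousAt.continuousWithinAt)
    (fun t _ => (hf t).differentiableAt.differentiableWithinAt) fun t ht => ?_
  rw [(hf t).deriv]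
  exact h t (interior_subset ht)

/-- A quantitative oscillation statement for a singular second-order linear equation. -/
theorem exists_nonpos_of_singular_ode {q q₁ q₂ : ℝ → ℝ} (hq : ∀ t, HasDerivAt q (q₁ t) t)
    (hq₁ : ∀ t, HasDerivAt q₁ (q₂ t) t) {n : ℕ} (hn : 2 ≤ n) {β μ : ℝ} (hβ : 0 ≤ β) (hμ : 0 < μ)
    (hode : ∀ t, (1 + t) * (4 * t * q₂ t + 2 * (n - 1) * q₁ t) = β * t * q₁ t - μ * q t)
    (hT : 16 * n * 2 ^ n / μ ≤ 1) :
    ∃ t ∈ Set.Icc 0 (16 * n * 2 ^ n / μ), q t ≤ 0 := by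
  set T : ℝ := 16 * n * 2 ^ n / μ with hTdef
  have hn' : (2 : ℝ) ≤ n := by exact_mod_cast hn
  have hTpos : 0 < T := by positivity
  by_contra! hpos
  -- At `0` the equation forces `q₁ 0 < 0`. At a later zero of `q₁` it forces `q₂ < 0`, so `q₁`
  -- cannot cross zero upwards.
  have hq1 : ∀ t ∈ Set.Icc 0 T, q₁ t ≤ 0 := by
    have h00 : q₁ 0 < 0 := by
      have h1 := hode 0
      have h2 := hpos 0 ⟨le_rfl, hTpos.le⟩
      by_contra! h3
      nlinarith [mul_pos hμ h2, mul_nonneg (show (0 : ℝ) ≤ n - 1 by linarith) h3]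
    intro t ht
    refine image_le_of_deriv_right_lt_deriv_boundary' (f := q₁) (f' := q₂) (B := fun _ => 0)
      (B' := fun _ => 0) (fun t _ => (hq₁ t).continuousAt.continuousWithinAt)
      (fun t _ => (hq₁ t).hasDerivWithinAt) h00.le continuousOn_const
      (fun t _ => hasDerivWithinAt_const _ _ _) (fun s hs h0 => ?_) ht
    have hs0 : 0 < s := lt_of_le_of_ne hs.1 (by rintro rfl; exact h00.ne h0)
    have h1 := hode s
    have h2 := mul_pos hμ (hpos s ⟨hs.1, hs.2.le⟩)
    rw [h0] at h1
    by_contra! h3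
    have h4 : 0 ≤ (1 + s) * (4 * s * q₂ s) := by positivity
    linarith
  -- Divide by `1 + t ≤ 2`, then by `4`, and lower `(n - 1) / 2 * q₁` to `n * q₁`. Multiplied by `t
  -- ^ (n - 1)`, the left side is the derivative of `t ^ n * q₁ t`.
  have hkey : ∀ t ∈ Set.Icc 0 T, t * q₂ t + n * q₁ t ≤ - (μ / 8) * q t := by
    intro t ht
    have h1 := hode t
    have h2 := hq1 t ht
    have h3 := mul_pos hμ (hpos t ht)
    have h4 : β * t * q₁ t ≤ 0 := mul_nonpos_of_nonneg_of_nonpos (mul_nonneg hβ ht.1) h2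
    have h5 : 4 * t * q₂ t + 2 * (n - 1) * q₁ t ≤ - (μ / 2) * q t := by
      by_contra! h6
      have h7 : (1 + t) * (- (μ / 2) * q t) <
          (1 + t) * (4 * t * q₂ t + 2 * (n - 1) * q₁ t) :=
        mul_lt_mul_of_pos_left h6 (by linarith [ht.1])
      nlinarith [mul_nonneg (show 0 ≤ 1 - t by linarith [ht.2]) h3.le]
    nlinarith [mul_nonpos_of_nonneg_of_nonpos (show (0 : ℝ) ≤ n + 1 by linarith) h2]
  have hanti : AntitoneOn q (Set.Icc 0 T) := antitoneOn_Icc_of_hasDerivAt hq hq1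
  set s : ℝ := T / 2 with hs
  have hs0 : 0 < s := by positivity
  have hsT : s ∈ Set.Icc 0 T := ⟨hs0.le, by linarith⟩
  have hpow : ∀ t : ℝ, HasDerivAt (fun t : ℝ => t ^ n) (n * t ^ (n - 1)) t := fun t => by
    simpa using hasDerivAt_pow n t
  have hsplit : ∀ t : ℝ, t ^ n = t ^ (n - 1) * t := fun t => by
    rw [← pow_succ]; congr 1; omega
  have hn0 : (n : ℝ) ≠ 0 := by positivity
  -- Integrate the previous inequality over `[0, s]`, where `q ≥ q s` by monotonicity.
  have hslope : q₁ s ≤ - (μ / (8 * n)) * q s := by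
    have hg : AntitoneOn (fun t => t ^ n * q₁ t + (μ / (8 * n) * q s) * t ^ n) (Set.Icc 0 s) := by
      refine antitoneOn_Icc_of_hasDerivAt
        (fun t => ((hpow t).mul (hq₁ t)).add ((hpow t).const_mul _)) fun t ht => ?_
      have htT : t ∈ Set.Icc 0 T := ⟨ht.1, ht.2.trans hsT.2⟩
      have h1 := hkey t htT
      have h2 : q s ≤ q t := hanti htT hsT ht.2
      have h3 : n * t ^ (n - 1) * q₁ t + t ^ n * q₂ t +
          μ / (8 * n) * q s * (n * t ^ (n - 1)) =
          t ^ (n - 1) * (t * q₂ t + n * q₁ t + μ / 8 * q s) := by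
        rw [hsplit t]
        field_simp
        ring
      rw [h3]
      refine mul_nonpos_of_nonneg_of_nonpos (pow_nonneg ht.1 _) ?_
      nlinarith [mul_le_mul_of_nonneg_left h2 (show 0 ≤ μ / 8 by positivity)]
    have h := hg ⟨le_rfl, hs0.le⟩ ⟨hs0.le, le_rfl⟩ hs0.le
    simp only [zero_pow (show n ≠ 0 by omega), zero_mul, mul_zero, add_zero] at h
    have hsn : 0 < s ^ n := by positivity
    by_contra! hc
    nlinarith [mul_lt_mul_of_pos_left hc hsn]
  have hflux : AntitoneOn (fun t => t ^ n * q₁ t) (Set.Icc 0 T) := by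
    refine antitoneOn_Icc_of_hasDerivAt (fun t => (hpow t).mul (hq₁ t)) fun t ht => ?_
    have h3 : n * t ^ (n - 1) * q₁ t + t ^ n * q₂ t =
        t ^ (n - 1) * (t * q₂ t + n * q₁ t) := by
      rw [hsplit t]
      ring
    rw [h3]
    refine mul_nonpos_of_nonneg_of_nonpos (pow_nonneg ht.1 _) ?_
    have := mul_pos hμ (hpos t ht)
    linarith [hkey t ht]
  -- Since `t ≤ 2 * s`, monotonicity of `t ^ n * q₁ t` loses at most the factor `2 ^ n` in the
  -- slope.
  have hq1' : ∀ t ∈ Set.Icc s T, q₁ t - q₁ s / 2 ^ n ≤ 0 := by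
    intro t ht
    have htT : t ∈ Set.Icc 0 T := ⟨hs0.le.trans ht.1, ht.2⟩
    have h1 : t ^ n * q₁ t ≤ s ^ n * q₁ s := hflux hsT htT ht.1
    have h2 : t ^ n ≤ (2 * s) ^ n := pow_le_pow_left₀ htT.1 (by linarith [ht.2]) n
    have h3 := mul_le_mul_of_nonpos_right h2 (hq1 t htT)
    rw [mul_pow] at h3
    have hsn : 0 < s ^ n := by positivity
    have h4 : s ^ n * (2 ^ n * q₁ t) ≤ s ^ n * q₁ s := by linarith
    have h5 := le_of_mul_le_mul_left h4 hsn
    rw [sub_nonpos, le_div_iff₀ (by positivity)]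
    linarith
  have hfin := antitoneOn_Icc_of_hasDerivAt
    (fun t => (hq t).sub ((hasDerivAt_id t).const_mul (q₁ s / 2 ^ n)))
    (fun t ht => by simpa using hq1' t ht) ⟨le_rfl, hsT.2⟩ ⟨hsT.2, le_rfl⟩ hsT.2
  simp only [Pi.sub_apply, id_eq] at hfin
  have hqT := hpos T ⟨hTpos.le, le_rfl⟩
  -- The length `T` is chosen so that `s = 8 * n * 2 ^ n / μ`. The guaranteed drop of `q` over `[s,
  -- T]` is then at least `q s`, contradicting `q T > 0`.
  have h1 : q₁ s / 2 ^ n * s ≤ - q s := by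
    have h2 : - (μ / (8 * n)) * q s / 2 ^ n * s = - q s := by
      rw [hs, hTdef]
      field_simp
      norm_num
    rw [← h2]
    gcongr
  have h3 : q₁ s / 2 ^ n * T = 2 * (q₁ s / 2 ^ n * s) := by rw [hs]; ring
  linarith

/-- The coefficients of the zonal harmonic of degree `k` in `n` variables. -/
def zonalCoeff (n k : ℕ) : ℕ → ℝ
  | 0 => 1
  | j + 1 => -((k - 2 * j) * (k - 2 * j - 1) / ((2 * j + 2) * (2 * j + n - 1))) * zonalCoeff n k j

theorem zonalCoeff_succ {n : ℕ} (hn : 2 ≤ n) (k j : ℕ) :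
    (2 * j + 2) * (2 * j + n - 1) * zonalCoeff n k (j + 1) =
      -((k - 2 * j) * (k - 2 * j - 1) * zonalCoeff n k j) := by
  have hn' : (2 : ℝ) ≤ n := by exact_mod_cast hn
  have h : (2 * (j : ℝ) + n - 1) ≠ 0 := by
    have : (0 : ℝ) ≤ j := by positivity
    linarith
  rw [zonalCoeff]
  field_simp

/-- The factor `(k - 2 * j) * (k - 2 * j - 1)` terminates the recursion. Hence the truncated
exponents `k - 2 * j` do no harm in the zonal harmonic. -/
theorem zonalCoeff_eq_zero (n k : ℕ) : ∀ j, k < 2 * j → zonalCoeff n k j = 0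
  | 0, h => by omega
  | j + 1, h => by
    rw [zonalCoeff]
    rcases lt_or_ge k (2 * j) with h1 | h1
    · rw [zonalCoeff_eq_zero n k j h1, mul_zero]
    · have : k = 2 * j ∨ k = 2 * j + 1 := by omega
      rcases this with rfl | rfl <;> simp

/-- The one-variable profile of the zonal harmonic. -/
def zonalPoly (n k : ℕ) : Polynomial ℝ :=
  ∑ j ∈ Finset.range (k + 1), Polynomial.C (zonalCoeff n k j) * Polynomial.X ^ j

theorem coeff_zonalPoly (n k j : ℕ) : (zonalPoly n k).coeff j = zonalCoeff n k j := by
  simp only [zonalPoly, Polynomial.finsetSum_coeff, Polynomial.coeff_C_mul_X_pow]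
  rw [Finset.sum_ite_eq]
  split_ifs with h
  · rfl
  · rw [Finset.mem_range] at h
    exact (zonalCoeff_eq_zero n k j (by omega)).symm

/-- Comparing coefficients of `X ^ j` reduces the equation to the recursion `zonalCoeff_succ`. -/
theorem zonalPoly_ode {n : ℕ} (hn : 2 ≤ n) (k : ℕ) :
    (1 + Polynomial.X) * (Polynomial.C 4 * (Polynomial.X * (zonalPoly n k).derivative.derivative) +
        Polynomial.C (2 * ((n : ℝ) - 1)) * (zonalPoly n k).derivative) =
      Polynomial.C (4 * (k : ℝ) + 2 * n - 8) * (Polynomial.X * (zonalPoly n k).derivative) -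
        Polynomial.C ((k : ℝ) * (k - 1)) * zonalPoly n k := by
  ext j
  have h := zonalCoeff_succ hn k j
  rw [add_mul, one_mul]
  rcases j with _ | _ | j <;>
  · simp only [Polynomial.coeff_add, Polynomial.coeff_sub, Polynomial.coeff_C_mul,
      Polynomial.coeff_X_mul, Polynomial.coeff_X_mul_zero, coeff_zonalPoly,
      Polynomial.coeff_derivative, zero_add] at h ⊢
    push_cast at h ⊢
    linarith

/-- The profile of the zonal harmonic of degree `k` has a zero at scale `k⁻²`. -/
theorem exists_root_zonalPoly {n k : ℕ} (hn : 2 ≤ n) (hk : 2 ≤ k)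
    (hT : 16 * n * 2 ^ n / ((k : ℝ) * (k - 1)) ≤ 1) :
    ∃ t, 0 < t ∧ t ≤ 16 * n * 2 ^ n / ((k : ℝ) * (k - 1)) ∧ (zonalPoly n k).eval t = 0 := by
  have hn' : (2 : ℝ) ≤ n := by exact_mod_cast hn
  have hk' : (2 : ℝ) ≤ k := by exact_mod_cast hk
  have hq0 : (zonalPoly n k).eval 0 = 1 := by
    rw [← Polynomial.coeff_zero_eq_eval_zero, coeff_zonalPoly, zonalCoeff]
  obtain ⟨s, hs, hs'⟩ := exists_nonpos_of_singular_ode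
    (fun t => (zonalPoly n k).hasDerivAt t) (fun t => (zonalPoly n k).derivative.hasDerivAt t) hn
    -- Both parameters are read off `zonalPoly_ode`; `β` is nonnegative because `k` and `n` are at
    -- least `2`.
    (β := 4 * k + 2 * n - 8) (μ := k * (k - 1)) (by linarith)
    (mul_pos (by linarith) (by linarith)) (fun t => by
      have := congrArg (Polynomial.eval t) (zonalPoly_ode hn k)
      simp only [Polynomial.eval_mul, Polynomial.eval_add, Polynomial.eval_sub,
        Polynomial.eval_one, Polynomial.eval_X, Polynomial.eval_C] at this
      linarith) hT
  obtain ⟨t, ht, ht0⟩ := intermediate_value_Icc' hs.1 (zonalPoly n k).continuous.continuousOn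
    (show (0 : ℝ) ∈ Set.Icc _ _ from ⟨hs', by rw [hq0]; norm_num⟩)
  refine ⟨t, lt_of_le_of_ne ht.1 ?_, ht.2.trans hs.2, ht0⟩
  rintro rfl
  exact one_ne_zero (hq0.symm.trans ht0)

end

/-! ### The zonal harmonic as a harmonic polynomial -/

section

variable {n : ℕ}

/-- The indices of the coordinates other than the first and the last one. -/
def midIdx (n : ℕ) : Finset (Fin (n + 1)) := {0, Fin.last n}ᶜ

theorem card_midIdx (hn : 1 ≤ n) : (midIdx n).card = n - 1 := by
  have h : (0 : Fin (n + 1)) ≠ Fin.last n := by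
    intro h
    have := congrArg Fin.val h
    simp at this
    omega
  rw [midIdx, Finset.card_compl, Finset.card_pair h, Fintype.card_fin]
  omega

/-- The sum of the squares of the middle coordinates. -/
def midSq (n : ℕ) : Poly n := ∑ i ∈ midIdx n, MvPolynomial.X i ^ 2

theorem isHomogeneous_midSq : (midSq n).IsHomogeneous 2 :=
  MvPolynomial.IsHomogeneous.sum _ _ _ fun i _ => by
    simpa using (MvPolynomial.isHomogeneous_X ℝ i).pow 2

theorem pderiv_midSq_of_mem {i : Fin (n + 1)} (hi : i ∈ midIdx n) :
    MvPolynomial.pderiv i (midSq n) = 2 * MvPolynomial.X i := by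
  rw [midSq, map_sum, Finset.sum_eq_single_of_mem i hi]
  · simp
  · intro j _ hj
    simp [MvPolynomial.pderiv_X_of_ne hj]

theorem pderiv_midSq_of_notMem {i : Fin (n + 1)} (hi : i ∉ midIdx n) :
    MvPolynomial.pderiv i (midSq n) = 0 := by
  rw [midSq, map_sum]
  refine Finset.sum_eq_zero fun j hj => ?_
  have : j ≠ i := by rintro rfl; exact hi hj
  simp [MvPolynomial.pderiv_X_of_ne this]

theorem polyLap_sum {ι : Type*} (s : Finset ι) (f : ι → Poly n) :
    polyLap (∑ j ∈ s, f j) = ∑ j ∈ s, polyLap (f j) := by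
  simp only [polyLap, map_sum]
  exact Finset.sum_comm

theorem polyLap_C_mul (c : ℝ) (P : Poly n) :
    polyLap (MvPolynomial.C c * P) = MvPolynomial.C c * polyLap P := by
  simp only [polyLap, MvPolynomial.pderiv_C_mul, Finset.mul_sum]

/-- The second coefficient is that of the Laplacian of a radial power in the `n - 1` middle
variables. The truncated exponents are harmless, since their coefficients vanish whenever truncation
occurs. -/
theorem polyLap_X_pow_mul_midSq_pow (hn : 1 ≤ n) (a j : ℕ) :
    polyLap (MvPolynomial.X 0 ^ a * midSq n ^ j) =
      MvPolynomial.C ((a : ℝ) * (a - 1)) * (MvPolynomial.X 0 ^ (a - 2) * midSq n ^ j) +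
      MvPolynomial.C (2 * (j : ℝ) * (2 * j + n - 3)) *
        (MvPolynomial.X 0 ^ a * midSq n ^ (j - 1)) := by
  classical
  have h0 : (0 : Fin (n + 1)) ∉ midIdx n := by simp [midIdx]
  have hz : ∀ i ∉ insert 0 (midIdx n), MvPolynomial.pderiv i
      (MvPolynomial.pderiv i (MvPolynomial.X 0 ^ a * midSq n ^ j)) = 0 := fun i hi => by
    rw [Finset.mem_insert, not_or] at hi
    have h1 : MvPolynomial.pderiv i (MvPolynomial.X 0 ^ a * midSq n ^ j : Poly n) = 0 := by
      simp [pderiv_midSq_of_notMem hi.2,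
        MvPolynomial.pderiv_X_of_ne (Ne.symm hi.1)]
    rw [h1, map_zero]
  rw [polyLap, ← Finset.sum_subset (Finset.subset_univ (insert 0 (midIdx n)))
    (fun i _ hi => hz i hi), Finset.sum_insert h0]
  congr 1
  · rcases a with _ | _ | a
    · simp [pderiv_midSq_of_notMem h0]
    · simp [pderiv_midSq_of_notMem h0]
    · simp [pderiv_midSq_of_notMem h0]
      ring
  · have hm : ∀ i ∈ midIdx n, MvPolynomial.pderiv i
        (MvPolynomial.pderiv i (MvPolynomial.X 0 ^ a * midSq n ^ j)) =
        MvPolynomial.C (2 * j : ℝ) * (MvPolynomial.X 0 ^ a * midSq n ^ (j - 1)) +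
        MvPolynomial.C (4 * (j : ℝ) * (j - 1)) *
          (MvPolynomial.X 0 ^ a * midSq n ^ (j - 2)) * MvPolynomial.X i ^ 2 := fun i hi => by
      have hi0 : (0 : Fin (n + 1)) ≠ i := by rintro rfl; exact h0 hi
      have h2 : MvPolynomial.pderiv i (2 : Poly n) = 0 := by
        rw [← map_ofNat MvPolynomial.C 2, MvPolynomial.pderiv_C]
      have hC2 : (MvPolynomial.C 2 : Poly n) = 2 := map_ofNat MvPolynomial.C 2
      have hC4 : (MvPolynomial.C 4 : Poly n) = 4 := map_ofNat MvPolynomial.C 4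
      rcases j with _ | _ | j
      · simp [MvPolynomial.pderiv_X_of_ne hi0]
      · simp [MvPolynomial.pderiv_X_of_ne hi0, pderiv_midSq_of_mem hi, h2, hC2]
        ring
      · simp [MvPolynomial.pderiv_X_of_ne hi0, pderiv_midSq_of_mem hi, h2, hC2, hC4]
        ring
    have hcard : ((midIdx n).card : Poly n) = n - 1 := by
      rw [card_midIdx hn, Nat.cast_sub hn, Nat.cast_one]
    have hS : ∑ i ∈ midIdx n, (MvPolynomial.X i ^ 2 : Poly n) = midSq n := rfl
    rw [Finset.sum_congr rfl hm, Finset.sum_add_distrib, Finset.sum_const,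
      nsmul_eq_mul, hcard, ← Finset.mul_sum, hS]
    have hpow : ∀ m : ℕ, m + 1 + 1 - 2 = m := fun m => by omega
    rcases j with _ | _ | j <;>
    · simp only [map_mul, map_sub, map_add, map_natCast, map_ofNat, Nat.cast_add, Nat.cast_one,
        Nat.cast_zero, Nat.add_sub_cancel, hpow, map_zero, map_one]
      ring

/-- The zonal harmonic of degree `k` in the first `n` variables, as a polynomial in `n + 1`
variables. -/
def zonalHarmonic (n k : ℕ) : Poly n :=
  ∑ j ∈ Finset.range (k + 1),
    MvPolynomial.C (zonalCoeff n k j) * (MvPolynomial.X 0 ^ (k - 2 * j) * midSq n ^ j)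

theorem isHomogeneous_zonalHarmonic (k : ℕ) : (zonalHarmonic n k).IsHomogeneous k := by
  refine MvPolynomial.IsHomogeneous.sum _ _ _ fun j _ => ?_
  by_cases hj : k < 2 * j
  · rw [zonalCoeff_eq_zero n k j hj, map_zero, zero_mul]
    exact MvPolynomial.isHomogeneous_zero _ _ _
  · have h := ((MvPolynomial.isHomogeneous_X ℝ (0 : Fin (n + 1))).pow (k - 2 * j)).mul
      (isHomogeneous_midSq.pow j)
    have h2 := (MvPolynomial.isHomogeneous_C (Fin (n + 1)) (zonalCoeff n k j)).mul h
    convert h2 using 1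
    omega

/-- The sum telescopes: by the recursion, the `x 0` part of term `j` cancels the middle part of term
`j + 1`. The two end terms have zero coefficients. -/
theorem polyLap_zonalHarmonic (hn : 2 ≤ n) (k : ℕ) : polyLap (zonalHarmonic n k) = 0 := by
  rw [zonalHarmonic, polyLap_sum]
  simp_rw [polyLap_C_mul, polyLap_X_pow_mul_midSq_pow (show 1 ≤ n by omega), mul_add]
  rw [Finset.sum_add_distrib, Finset.sum_range_succ, Finset.sum_range_succ' _ k]
  have h1 : ∀ j ∈ Finset.range k, MvPolynomial.C (zonalCoeff n k j) *
      (MvPolynomial.C (((k - 2 * j : ℕ) : ℝ) * ((k - 2 * j : ℕ) - 1)) *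
        (MvPolynomial.X 0 ^ (k - 2 * j - 2) * midSq n ^ j)) =
      - (MvPolynomial.C (zonalCoeff n k (j + 1)) *
      (MvPolynomial.C (2 * ((j + 1 : ℕ) : ℝ) * (2 * (j + 1 : ℕ) + n - 3)) *
        (MvPolynomial.X 0 ^ (k - 2 * (j + 1)) * midSq n ^ (j + 1 - 1)))) := by
    intro j _
    by_cases hj : k < 2 * j
    · rw [zonalCoeff_eq_zero n k j hj, zonalCoeff_eq_zero n k (j + 1) (by omega)]
      simp
    · have h := zonalCoeff_succ hn k j
      rw [← mul_assoc, ← mul_assoc (MvPolynomial.C (zonalCoeff n k (j + 1))), ← map_mul,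
        ← map_mul, ← neg_mul, ← map_neg, show k - 2 * j - 2 = k - 2 * (j + 1) by omega, Nat.add_sub_cancel,
        Nat.cast_sub (by omega)]
      congr 2
      push_cast
      linarith
  have hlast : zonalCoeff n k k * ((k - 2 * k : ℕ) * ((k - 2 * k : ℕ) - 1) : ℝ) = 0 := by
    simp [show k - 2 * k = 0 by omega]
  rw [Finset.sum_congr rfl h1, Finset.sum_neg_distrib, ← mul_assoc (MvPolynomial.C _),
    ← map_mul, hlast]
  simp

theorem polyFun_zonalHarmonic (k : ℕ) (x : Ambient n) :
    polyFun (zonalHarmonic n k) x =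
      ∑ j ∈ Finset.range (k + 1), zonalCoeff n k j *
        (x 0 ^ (k - 2 * j) * (∑ i ∈ midIdx n, x i ^ 2) ^ j) := by
  simp [polyFun, zonalHarmonic, midSq]

/-- The slope equation is written without division, so it includes points with `x 0 = 0`, in
particular the pole. -/
theorem polyFun_zonalHarmonic_of_eq (k : ℕ) {x : Ambient n} {t : ℝ}
    (h : ∑ i ∈ midIdx n, x i ^ 2 = t * x 0 ^ 2) :
    polyFun (zonalHarmonic n k) x = x 0 ^ k * (zonalPoly n k).eval t := by
  rw [polyFun_zonalHarmonic, zonalPoly, Polynomial.eval_finsetSum, Finset.mul_sum]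
  refine Finset.sum_congr rfl fun j _ => ?_
  by_cases hj : k < 2 * j
  · simp [zonalCoeff_eq_zero n k j hj]
  · rw [h, mul_pow, ← pow_mul]
    simp only [Polynomial.eval_mul, Polynomial.eval_C, Polynomial.eval_pow, Polynomial.eval_X]
    have : x 0 ^ k = x 0 ^ (k - 2 * j) * x 0 ^ (2 * j) := by
      rw [← pow_add]; congr 1; omega
    rw [this]
    ring

end

/-! ### Volumes of sectors in balls about the pole -/

section

open scoped Pointwise

variable {n : ℕ}

theorem zero_ne_last (hn : 1 ≤ n) : (0 : Fin (n + 1)) ≠ Fin.last n := by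
  intro h
  have := congrArg Fin.val h
  simp at this
  omega

theorem mem_midIdx {i : Fin (n + 1)} : i ∈ midIdx n ↔ i ≠ 0 ∧ i ≠ Fin.last n := by
  simp [midIdx]

theorem prod_univ_eq_mid {M : Type*} [CommMonoid M] (hn : 1 ≤ n) (f : Fin (n + 1) → M) :
    ∏ i, f i = f 0 * f (Fin.last n) * ∏ i ∈ midIdx n, f i := by
  rw [← Finset.prod_pair (zero_ne_last hn), midIdx]
  exact (Finset.prod_mul_prod_compl _ f).symm

theorem sum_univ_eq_mid {M : Type*} [AddCommMonoid M] (hn : 1 ≤ n) (f : Fin (n + 1) → M) :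
    ∑ i, f i = f 0 + f (Fin.last n) + ∑ i ∈ midIdx n, f i := by
  rw [← Finset.sum_pair (zero_ne_last hn), midIdx]
  exact (Finset.sum_add_sum_compl _ f).symm

theorem norm_sq_eq_mid (hn : 1 ≤ n) (x : Ambient n) :
    ‖x‖ ^ 2 = x 0 ^ 2 + x (Fin.last n) ^ 2 + ∑ i ∈ midIdx n, x i ^ 2 := by
  rw [EuclideanSpace.real_norm_sq_eq, sum_univ_eq_mid hn]

/-- An open coordinate box in the ambient space. -/
def box (a b : Fin (n + 1) → ℝ) : Set (Ambient n) := {x | ∀ i, x i ∈ Set.Ioo (a i) (b i)}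

theorem volume_box (a b : Fin (n + 1) → ℝ) :
    volume (box a b) = ∏ i, ENNReal.ofReal (b i - a i) := by
  have h : box a b = (MeasurableEquiv.toLp 2 (Fin (n + 1) → ℝ)).symm ⁻¹'
      (Set.univ.pi fun i => Set.Ioo (a i) (b i)) := by
    ext x
    simp [box]
  rw [h, (EuclideanSpace.volume_preserving_symm_measurableEquiv_toLp
    (Fin (n + 1))).measure_preimage_equiv, Real.volume_pi_Ioo]

/-- The pole of the sphere on the last coordinate axis. -/
def pole (n : ℕ) : Sph n :=
  ⟨EuclideanSpace.single (Fin.last n) 1, by simp⟩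

theorem coe_pole : (pole n : Ambient n) = EuclideanSpace.single (Fin.last n) 1 := rfl

theorem cos_angle_pole (x : Ambient n) :
    Real.cos (InnerProductGeometry.angle (pole n : Ambient n) x) = x (Fin.last n) / ‖x‖ := by
  rw [InnerProductGeometry.cos_angle, norm_coe_sph, coe_pole]
  simp [EuclideanSpace.inner_single_left]

/-- Since `cos R < 1 / √(R ^ 2 + 1)`, the cone of slope `R` about the last axis lies inside the cone
of angle `R`. -/
theorem angle_pole_lt {R : ℝ} (hR : 0 < R) (hR1 : R < 1) {x : Ambient n} (hx : x ≠ 0)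
    (hz : 0 ≤ x (Fin.last n)) (h : ‖x‖ ^ 2 ≤ x (Fin.last n) ^ 2 * (R ^ 2 + 1)) :
    InnerProductGeometry.angle (pole n : Ambient n) x < R := by
  by_contra! hc
  have hpi := Real.pi_gt_three
  have h1 : Real.cos (InnerProductGeometry.angle (pole n : Ambient n) x) ≤ Real.cos R :=
    Real.cos_le_cos_of_nonneg_of_le_pi hR.le (InnerProductGeometry.angle_le_pi _ _) hc
  have h2 := Real.cos_lt_one_div_sqrt_sq_add_one (x := R) (by linarith) (by linarith) hR.ne'
  rw [cos_angle_pole] at h1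
  have h3 := h1.trans_lt h2
  rw [div_lt_div_iff₀ (norm_pos_iff.mpr hx) (by positivity), one_mul] at h3
  have h4 : x (Fin.last n) * √(R ^ 2 + 1) ≥ ‖x‖ := by
    refine abs_le_of_sq_le_sq' ?_ (by positivity) |>.2
    rw [mul_pow, Real.sq_sqrt (by positivity)]
    exact h
  linarith

/-- Uses `sin R < R`: the distance of `x` from the last axis is less than `R`. -/
theorem sq_sub_lt_of_angle_pole_lt {R : ℝ} (hR : 0 < R) (hR1 : R < 1) {x : Sph n}
    (h : InnerProductGeometry.angle (pole n : Ambient n) x < R) :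
    0 < (x : Ambient n) (Fin.last n) ∧ 1 - (x : Ambient n) (Fin.last n) ^ 2 < R ^ 2 := by
  have hpi := Real.pi_gt_three
  have h1 := Real.cos_lt_cos_of_nonneg_of_le_pi (InnerProductGeometry.angle_nonneg _ _)
    (by linarith) h
  rw [cos_angle_pole, norm_coe_sph, div_one] at h1
  have h2 : 0 < Real.cos R := Real.cos_pos_of_mem_Ioo ⟨by linarith, by linarith⟩
  have h3 := Real.sin_sq_add_cos_sq R
  have h4 : Real.sin R ^ 2 ≤ R ^ 2 := by
    have := Real.sin_lt hR
    have := Real.sin_pos_of_pos_of_lt_pi hR (by linarith)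
    nlinarith
  refine ⟨h2.trans h1, ?_⟩
  nlinarith

theorem continuous_angle_pole :
    Continuous fun x : Sph n => InnerProductGeometry.angle (pole n : Ambient n) x := by
  simp only [InnerProductGeometry.angle, norm_coe_sph]
  fun_prop

theorem measurableSet_geodesicBall_pole (R : ℝ) : MeasurableSet (geodesicBall (pole n) R) :=
  (isOpen_lt continuous_angle_pole continuous_const).measurableSet

theorem vol_eq {s : Set (Sph n)} (hs : MeasurableSet s) :
    vol n s = (n + 1 : ℕ) * volume (Set.Ioo (0 : ℝ) 1 • (Subtype.val '' s : Set (Ambient n))) := by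
  rw [vol, Measure.toSphere_apply' _ hs, finrank_euclideanSpace_fin]

/-- A geodesic ball about the pole contains, in the cone over it, a box of comparable size. -/
theorem box_subset_cone_ball (hn : 1 ≤ n) {R : ℝ} (hR : 0 < R) (hR1 : R < 1) :
    box (fun i => if i = Fin.last n then 1 / 4 else -(R / (4 * n)))
      (fun i => if i = Fin.last n then 1 / 2 else R / (4 * n)) ⊆
      Set.Ioo (0 : ℝ) 1 • (Subtype.val '' geodesicBall (pole n) R : Set (Ambient n)) := by
  intro y hy
  have hn' : (1 : ℝ) ≤ n := by exact_mod_cast hn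
  have hz : y (Fin.last n) ∈ Set.Ioo (1 / 4 : ℝ) (1 / 2) := by simpa using hy (Fin.last n)
  have hi : ∀ i, i ≠ Fin.last n → y i ^ 2 ≤ (R / (4 * n)) ^ 2 := fun i hi => by
    have h := hy i
    simp only [hi, if_false] at h
    exact sq_le_sq' h.1.le h.2.le
  -- There are `n` coordinates besides the last. The bound suffices because the last coordinate
  -- exceeds `1 / 4`, so `R ^ 2 / 16` is at most its square times `R ^ 2`.
  have hsum : y 0 ^ 2 + ∑ i ∈ midIdx n, y i ^ 2 ≤ R ^ 2 / 16 := by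
    have h1 : ∑ i ∈ midIdx n, y i ^ 2 ≤ (n - 1) * (R / (4 * n)) ^ 2 := by
      have := Finset.sum_le_card_nsmul (midIdx n) (fun i => y i ^ 2) ((R / (4 * n)) ^ 2)
        fun i h => hi i (mem_midIdx.mp h).2
      rwa [card_midIdx hn, nsmul_eq_mul, Nat.cast_sub hn, Nat.cast_one] at this
    have h2 := hi 0 (zero_ne_last hn)
    have h3 : n * (R / (4 * n)) ^ 2 ≤ R ^ 2 / 16 := by
      have : n * (R / (4 * n)) ^ 2 = R ^ 2 / 16 / n := by field_simp; norm_num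
      rw [this]
      exact div_le_self (by positivity) hn'
    linarith
  have hnorm := norm_sq_eq_mid hn y
  have hne : y ≠ 0 := by
    rintro rfl
    have := hz.1
    norm_num at this
  have hlt : ‖y‖ < 1 := by
    refine lt_of_pow_lt_pow_left₀ 2 zero_le_one ?_
    nlinarith [hz.1, hz.2]
  refine Set.mem_smul.mpr ⟨‖y‖, ⟨norm_pos_iff.mpr hne, hlt⟩, _, ⟨proj y hne, ?_, rfl⟩, ?_⟩
  · change InnerProductGeometry.angle _ _ < R
    rw [coe_proj, InnerProductGeometry.angle_smul_right_of_pos _ _ (by positivity)]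
    refine angle_pole_lt hR hR1 hne (by linarith [hz.1]) ?_
    nlinarith [mul_nonneg (sq_nonneg R) (show 0 ≤ y (Fin.last n) ^ 2 - 1 / 16 by nlinarith [hz.1])]
  · rw [coe_proj, smul_smul, mul_inv_cancel₀ (norm_ne_zero_iff.mpr hne), one_smul]

/-- The thin sector about the first coordinate axis with squared slope `t`. -/
def sector (n : ℕ) (t : ℝ) : Set (Sph n) :=
  {x | 0 < (x : Ambient n) 0 ∧
    ∑ i ∈ midIdx n, (x : Ambient n) i ^ 2 < t * (x : Ambient n) 0 ^ 2}

theorem isOpen_sector (t : ℝ) : IsOpen (sector n t) := by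
  rw [sector, Set.ofPred_and]
  refine IsOpen.inter (isOpen_lt ?_ ?_) (isOpen_lt ?_ ?_) <;> fun_prop

theorem cone_sector_subset_box (hn : 1 ≤ n) {R t : ℝ} (hR : 0 < R) (hR1 : R < 1) (ht : 0 < t) :
    Set.Ioo (0 : ℝ) 1 • (Subtype.val '' (sector n t ∩ geodesicBall (pole n) R) :
      Set (Ambient n)) ⊆
      box (fun i => if i = 0 then 0 else if i = Fin.last n then 0 else -(√t * R))
        (fun i => if i = 0 then R else if i = Fin.last n then 1 else √t * R) := by
  rintro y hy
  obtain ⟨r, hr, _, ⟨x, ⟨⟨hx0, hxm⟩, hxR⟩, rfl⟩, rfl⟩ := Set.mem_smul.mp hy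
  obtain ⟨hz0, hz⟩ := sq_sub_lt_of_angle_pole_lt hR hR1 hxR
  have hnorm := norm_sq_eq_mid hn (x : Ambient n)
  rw [norm_coe_sph] at hnorm
  have hM : 0 ≤ ∑ i ∈ midIdx n, (x : Ambient n) i ^ 2 := Finset.sum_nonneg fun i _ => sq_nonneg _
  have hx0R : (x : Ambient n) 0 < R := by
    refine lt_of_pow_lt_pow_left₀ 2 hR.le ?_
    linarith
  have hz1 : (x : Ambient n) (Fin.last n) ≤ 1 := by nlinarith [sq_nonneg ((x : Ambient n) 0)]
  intro i
  have hri : (r • (x : Ambient n)) i = r * (x : Ambient n) i := rfl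
  rw [hri]
  by_cases h0 : i = 0
  · subst h0
    simp only [if_true]
    exact ⟨mul_pos hr.1 hx0, by nlinarith [hr.1, hr.2]⟩
  by_cases hl : i = Fin.last n
  · subst hl
    simp only [h0, if_true, if_false]
    exact ⟨mul_pos hr.1 hz0, by nlinarith [hr.1, hr.2]⟩
  simp only [h0, hl, if_false]
  have h1 : (x : Ambient n) i ^ 2 ≤ ∑ i ∈ midIdx n, (x : Ambient n) i ^ 2 :=
    Finset.single_le_sum (f := fun i => (x : Ambient n) i ^ 2) (fun i _ => sq_nonneg _)
      (mem_midIdx.mpr ⟨h0, hl⟩)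
  have h2 : (r * (x : Ambient n) i) ^ 2 < (√t * R) ^ 2 := by
    rw [mul_pow, mul_pow, Real.sq_sqrt ht.le]
    have h3 : (x : Ambient n) 0 ^ 2 < R ^ 2 := by nlinarith
    have h4 : t * (x : Ambient n) 0 ^ 2 < t * R ^ 2 := mul_lt_mul_of_pos_left h3 ht
    have h5 : r ^ 2 ≤ 1 := by nlinarith [hr.1, hr.2]
    nlinarith [mul_le_mul_of_nonneg_right h5 (sq_nonneg ((x : Ambient n) i))]
  exact abs_lt.mp (abs_lt_of_sq_lt_sq h2 (by positivity))

/-- Volume of the part of a sector in a geodesic ball about the pole, relative to the ball. -/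
theorem vol_sector_div_le (hn : 1 ≤ n) {R t : ℝ} (hR : 0 < R) (hR1 : R < 1) (ht : 0 < t) :
    vol n (sector n t ∩ geodesicBall (pole n) R) / vol n (geodesicBall (pole n) R) ≤
      ENNReal.ofReal (8 * n * (4 * n * √t) ^ (n - 1)) := by
  have hn' : (1 : ℝ) ≤ n := by exact_mod_cast hn
  have hnum : volume (Set.Ioo (0 : ℝ) 1 •
      (Subtype.val '' (sector n t ∩ geodesicBall (pole n) R) : Set (Ambient n))) ≤
      ENNReal.ofReal (R * (2 * √t * R) ^ (n - 1)) := by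
    refine (measure_mono (cone_sector_subset_box hn hR hR1 ht)).trans_eq ?_
    rw [volume_box, prod_univ_eq_mid hn, Finset.prod_congr rfl
      (g := fun _ => ENNReal.ofReal (2 * √t * R)), Finset.prod_const, card_midIdx hn]
    · simp only [if_true, (zero_ne_last hn).symm, if_false, sub_zero, ENNReal.ofReal_one, mul_one]
      rw [ENNReal.ofReal_mul hR.le, ENNReal.ofReal_pow (by positivity)]
    · intro i hi
      obtain ⟨h0, hl⟩ := mem_midIdx.mp hi
      simp only [h0, hl, if_false]
      congr 1
      ring
  have hden : ENNReal.ofReal (R / (8 * n) * (R / (2 * n)) ^ (n - 1)) ≤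
      volume (Set.Ioo (0 : ℝ) 1 •
        (Subtype.val '' (geodesicBall (pole n) R) : Set (Ambient n))) := by
    refine le_of_eq_of_le ?_ (measure_mono (box_subset_cone_ball hn hR hR1))
    rw [volume_box, prod_univ_eq_mid hn, Finset.prod_congr rfl
      (g := fun _ => ENNReal.ofReal (R / (2 * n))), Finset.prod_const, card_midIdx hn]
    · simp only [if_true, zero_ne_last hn, if_false]
      rw [← ENNReal.ofReal_mul (by rw [sub_neg_eq_add]; positivity),
        ENNReal.ofReal_mul (by positivity), ENNReal.ofReal_pow (by positivity)]
      congr 2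
      field_simp
      norm_num
    · intro i hi
      simp only [(mem_midIdx.mp hi).2, if_false]
      congr 1
      field_simp
      norm_num
  have hpos : 0 < R / (8 * n) * (R / (2 * n)) ^ (n - 1) := by positivity
  rw [vol_eq (measurableSet_geodesicBall_pole R),
    vol_eq ((isOpen_sector t).measurableSet.inter (measurableSet_geodesicBall_pole R)),
    ENNReal.mul_div_mul_left _ _ (by positivity) (ENNReal.natCast_ne_top _)]
  refine (ENNReal.div_le_div hnum hden).trans_eq ?_
  rw [← ENNReal.ofReal_div_of_pos hpos]
  congr 1
  -- Both box volumes scale as `R ^ n`, so `R` cancels: the estimate is uniform over all scales.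
  rw [mul_div_mul_comm, ← div_pow]
  congr 1
  · field_simp
  · congr 1
    field_simp
    norm_num

end

/-! ### Nodal domains and the two ranges of eigenvalues -/

section

variable {n : ℕ}

/-- The point at angle `ε` from the pole in the direction of the first coordinate axis. -/
def nearPole (hn : 1 ≤ n) (ε : ℝ) : Sph n :=
  ⟨Real.sin ε • EuclideanSpace.single 0 1 + Real.cos ε • EuclideanSpace.single (Fin.last n) 1, by
    rw [mem_sphere_zero_iff_norm, ← sq_eq_sq₀ (norm_nonneg _) zero_le_one, norm_sq_eq_mid hn,
      Finset.sum_eq_zero]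
    · simp [(zero_ne_last hn).symm, zero_ne_last hn]
    · intro i hi
      simp [mem_midIdx.mp hi]⟩

theorem nearPole_zero (hn : 1 ≤ n) (ε : ℝ) : (nearPole hn ε : Ambient n) 0 = Real.sin ε := by
  simp [nearPole, zero_ne_last hn]

theorem nearPole_last (hn : 1 ≤ n) (ε : ℝ) :
    (nearPole hn ε : Ambient n) (Fin.last n) = Real.cos ε := by
  simp [nearPole, (zero_ne_last hn).symm]

theorem sum_midIdx_nearPole (hn : 1 ≤ n) (ε : ℝ) :
    ∑ i ∈ midIdx n, (nearPole hn ε : Ambient n) i ^ 2 = 0 :=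
  Finset.sum_eq_zero fun i hi => by simp [nearPole, mem_midIdx.mp hi]

theorem angle_pole_nearPole (hn : 1 ≤ n) {ε : ℝ} (h0 : 0 ≤ ε) (h1 : ε ≤ Real.pi) :
    InnerProductGeometry.angle (pole n : Ambient n) (nearPole hn ε) = ε := by
  refine Real.injOn_cos ⟨InnerProductGeometry.angle_nonneg _ _,
    InnerProductGeometry.angle_le_pi _ _⟩ ⟨h0, h1⟩ ?_
  rw [cos_angle_pole, norm_coe_sph, div_one, nearPole_last]

theorem polyFun_zonalHarmonic_nearPole (hn : 1 ≤ n) (k : ℕ) (ε : ℝ) :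
    polyFun (zonalHarmonic n k) (nearPole hn ε) = Real.sin ε ^ k := by
  rw [polyFun_zonalHarmonic_of_eq k (t := 0) (by rw [sum_midIdx_nearPole, zero_mul]),
    ← Polynomial.coeff_zero_eq_eval_zero, coeff_zonalPoly, zonalCoeff, mul_one, nearPole_zero]

/-- The zonal harmonic is an eigenfunction. -/
theorem isEigenfunction_zonalHarmonic (hn : 2 ≤ n) (k : ℕ) :
    IsEigenfunction n (k * (k + n - 1)) fun p => polyFun (zonalHarmonic n k) p where
  smooth := contMDiff_polyFun _
  ne_zero h := by
    have := congrFun h (nearPole (by omega) (Real.pi / 2))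
    rw [polyFun_zonalHarmonic_nearPole] at this
    simp at this
  eigen p := by
    rw [laplaceBeltrami_polyFun (isHomogeneous_zonalHarmonic k), polyLap_zonalHarmonic hn]
    simp [polyFun]

/-- A root of the profile confines the nodal domain around the first axis to a sector. -/
theorem nodal_subset_sector {k : ℕ} {t : ℝ} (hroot : (zonalPoly n k).eval t = 0)
    {x : Sph n} (hx : x ∈ sector n t) (hne : polyFun (zonalHarmonic n k) x ≠ 0) :
    connectedComponentIn {y : Sph n | polyFun (zonalHarmonic n k) y ≠ 0} x ⊆ sector n t := by
  refine IsPreconnected.subset_left_of_subset_union (isOpen_sector t)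
    -- This open set is disjoint from the sector, and every point in neither of the two satisfies
    -- the slope equation with the root `t`, hence is a zero of the harmonic.
    (v := {y : Sph n | (y : Ambient n) 0 < 0} ∪
      {y : Sph n | t * (y : Ambient n) 0 ^ 2 < ∑ i ∈ midIdx n, (y : Ambient n) i ^ 2})
    ((isOpen_lt (by fun_prop) (by fun_prop)).union (isOpen_lt (by fun_prop) (by fun_prop)))
    ?_ ?_ ⟨x, mem_connectedComponentIn hne, hx⟩ isPreconnected_connectedComponentIn
  · rw [Set.disjoint_left]
    rintro y ⟨h1, h2⟩ (h3 | h3)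
    · exact lt_asymm h1 h3
    · exact lt_asymm h2 h3
  · intro y hy
    have hy' : polyFun (zonalHarmonic n k) y ≠ 0 := connectedComponentIn_subset _ _ hy
    have hM : 0 ≤ ∑ i ∈ midIdx n, (y : Ambient n) i ^ 2 := Finset.sum_nonneg fun i _ => sq_nonneg _
    by_contra hc
    simp only [Set.mem_union, not_or, sector, Set.mem_ofPred_eq, not_and_or, not_lt] at hc
    obtain ⟨h1, h2, h3⟩ := hc
    refine hy' ?_
    rw [polyFun_zonalHarmonic_of_eq k (t := t) (le_antisymm h3 ?_), hroot, mul_zero]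
    rcases h1 with h1 | h1
    · simpa [le_antisymm h1 h2] using hM
    · exact h1

/-- For bounded eigenvalues any nodal domain will do. -/
theorem exists_nodal_domain_of_sqrt_pow_le {lam : ℝ} (h : IsEigenvalue n lam) {R : ℝ} (hR : 0 < R)
    {C : ℝ} (hC0 : 0 < C) (hC : √lam ^ (n - 1) ≤ C) :
    ∃ φ : Sph n → ℝ, IsEigenfunction n lam φ ∧ ∃ A : Set (Sph n), IsNodalDomain φ A ∧
      ∃ p : Sph n, (A ∩ geodesicBall p (R / 2)).Nonempty ∧
        vol n (A ∩ geodesicBall p R) / vol n (geodesicBall p R) ≤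
          ENNReal.ofReal C / ENNReal.ofReal √lam ^ (n - 1) := by
  obtain ⟨φ, hφ⟩ := h
  obtain ⟨x, hx⟩ := Function.ne_iff.mp hφ.ne_zero
  have hx' : φ x ≠ 0 := hx
  refine ⟨φ, hφ, _, ⟨x, hx', rfl⟩, x, ⟨x, mem_connectedComponentIn hx', ?_⟩, ?_⟩
  · change InnerProductGeometry.angle _ _ < R / 2
    rw [InnerProductGeometry.angle_self (coe_sph_ne_zero x)]
    positivity
  -- The volume fraction is at most one, and the right-hand side is at least one.
  · refine (ENNReal.div_le_div_right (measure_mono Set.inter_subset_right) _).trans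
      (ENNReal.div_self_le_one.trans ?_)
    rw [← ENNReal.ofReal_pow (Real.sqrt_nonneg _)]
    rw [ENNReal.le_div_iff_mul_le (Or.inr (by simpa using hC0)) (Or.inl ENNReal.ofReal_ne_top),
      one_mul]
    exact ENNReal.ofReal_le_ofReal hC

/-- For large eigenvalues the zonal harmonic, viewed from the pole on the unused axis, has a thin
nodal domain at every scale. -/
theorem exists_thin_nodal_domain (hn : 2 ≤ n) {lam : ℝ} (h : IsEigenvalue n lam)
    (hlam : 32 * n ^ 2 * 2 ^ n < lam) {R : ℝ} (hR : 0 < R) (hRl : R * √lam < 1) :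
    ∃ φ : Sph n → ℝ, IsEigenfunction n lam φ ∧ ∃ A : Set (Sph n), IsNodalDomain φ A ∧
      ∃ p : Sph n, (A ∩ geodesicBall p (R / 2)).Nonempty ∧
        vol n (A ∩ geodesicBall p R) / vol n (geodesicBall p R) ≤
          ENNReal.ofReal (8 * n * (4 * n * √(32 * n ^ 2 * 2 ^ n)) ^ (n - 1)) /
            ENNReal.ofReal √lam ^ (n - 1) := by
  have hn1 : 1 ≤ n := by omega
  have hn' : (2 : ℝ) ≤ n := by exact_mod_cast hn
  obtain ⟨k, rfl⟩ := exists_degree_of_isEigenvalue h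
  set lam : ℝ := k * (k + n - 1) with hdef
  have h2n : (1 : ℝ) ≤ 2 ^ n := one_le_pow₀ (by norm_num)
  have hlam1 : 1 ≤ lam := by nlinarith
  have hR1 : R < 1 := by
    have : 1 ≤ √lam := Real.one_le_sqrt.mpr hlam1
    nlinarith
  have hk1 : 1 ≤ k := by
    rcases Nat.eq_zero_or_pos k with rfl | hk
    · simp [hdef] at hlam1
      linarith
    · exact hk
  have hk1' : (1 : ℝ) ≤ k := by exact_mod_cast hk1
  have hlamk : lam ≤ n * k ^ 2 := by
    rw [hdef]
    nlinarith [mul_nonneg (show (0 : ℝ) ≤ k - 1 by linarith) (show (0 : ℝ) ≤ n - 1 by linarith),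
      mul_nonneg (show (0 : ℝ) ≤ k by linarith) (mul_nonneg (show (0 : ℝ) ≤ k - 1 by linarith)
        (show (0 : ℝ) ≤ n - 1 by linarith))]
  have hk2 : 32 * n * 2 ^ n < (k : ℝ) ^ 2 := by
    have : (n : ℝ) * (32 * n * 2 ^ n) < n * k ^ 2 := by nlinarith
    exact lt_of_mul_lt_mul_left this (by positivity)
  have hk : 2 ≤ k := by
    by_contra hc
    have : k = 1 := by omega
    rw [this] at hk2
    norm_num at hk2
    nlinarith
  have hk' : (2 : ℝ) ≤ k := by exact_mod_cast hk
  have hkk : (k : ℝ) ^ 2 / 2 ≤ k * (k - 1) := by nlinarith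
  have hkpos : (0 : ℝ) < k * (k - 1) := by nlinarith
  obtain ⟨t, ht0, htT, hroot⟩ := exists_root_zonalPoly hn hk (by
    rw [div_le_one hkpos]
    linarith)
  -- Combine `lam ≤ n * k ^ 2 ≤ n * (2 * k * (k - 1))` with the bound on the root. This product is
  -- the quantity under the square root in the constant.
  have htlam : t * lam ≤ 32 * n ^ 2 * 2 ^ n := by
    rw [le_div_iff₀ hkpos] at htT
    have h1 : t * lam ≤ t * (n * (2 * (k * (k - 1)))) := by
      refine mul_le_mul_of_nonneg_left (hlamk.trans ?_) ht0.le
      exact mul_le_mul_of_nonneg_left (by linarith) (by positivity)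
    nlinarith [mul_le_mul_of_nonneg_left htT (show (0 : ℝ) ≤ n by positivity)]
  have hpi := Real.pi_gt_three
  have hsin : 0 < Real.sin (R / 4) := Real.sin_pos_of_pos_of_lt_pi (by positivity) (by linarith)
  have hne : polyFun (zonalHarmonic n k) (nearPole hn1 (R / 4)) ≠ 0 := by
    rw [polyFun_zonalHarmonic_nearPole]
    positivity
  -- The angle `R / 4` puts the point inside the half ball. Its middle coordinates vanish, so it
  -- lies on the core of the sector.
  have hsec : nearPole hn1 (R / 4) ∈ sector n t := by
    refine ⟨by rwa [nearPole_zero], ?_⟩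
    rw [sum_midIdx_nearPole, nearPole_zero]
    positivity
  refine ⟨_, isEigenfunction_zonalHarmonic hn k, _, ⟨nearPole hn1 (R / 4), hne, rfl⟩, pole n,
    ⟨nearPole hn1 (R / 4), mem_connectedComponentIn hne, ?_⟩, ?_⟩
  · change InnerProductGeometry.angle _ _ < R / 2
    rw [angle_pole_nearPole hn1 (by positivity) (by linarith)]
    linarith
  · refine (ENNReal.div_le_div_right (measure_mono (Set.inter_subset_inter_left _
      (nodal_subset_sector hroot hsec hne))) _).trans
      ((vol_sector_div_le hn1 hR hR1 ht0).trans ?_)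
    have hsl : 0 < √lam := Real.sqrt_pos.mpr (by linarith)
    rw [← ENNReal.ofReal_pow hsl.le, ← ENNReal.ofReal_div_of_pos (by positivity)]
    refine ENNReal.ofReal_le_ofReal ?_
    rw [le_div_iff₀ (by positivity), mul_assoc, ← mul_pow, mul_assoc (4 * (n : ℝ)),
      ← Real.sqrt_mul ht0.le]
    gcongr

end

end RoundSphere

end

theorem mainTheorem9 (n : ℕ) (hn : 1 ≤ n) :
    ∃ C : ℝ, 0 < C ∧
      ∀ lam : ℝ, RoundSphere.IsEigenvalue n lam →
      ∀ R : ℝ, 0 < R → R * Real.sqrt lam < 1 →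
        ∃ φ : RoundSphere.Sph n → ℝ, RoundSphere.IsEigenfunction n lam φ ∧
        ∃ A : Set (RoundSphere.Sph n), RoundSphere.IsNodalDomain φ A ∧
        ∃ p : RoundSphere.Sph n,
          (A ∩ RoundSphere.geodesicBall p (R / 2)).Nonempty ∧
          RoundSphere.vol n (A ∩ RoundSphere.geodesicBall p R) /
              RoundSphere.vol n (RoundSphere.geodesicBall p R) ≤
            ENNReal.ofReal C / ENNReal.ofReal (Real.sqrt lam) ^ (n - 1) := by
  have hn' : (1 : ℝ) ≤ n := by exact_mod_cast hn
  -- This is the bound of `vol_sector_div_le` with `t` replaced by the upper bound for `t * lam`. It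
  -- also dominates `√lam ^ (n - 1)` below the threshold; for `n = 1` that power is `1`.
  refine ⟨8 * n * (4 * n * √(32 * n ^ 2 * 2 ^ n)) ^ (n - 1), by positivity, ?_⟩
  intro lam hlam R hR hRl
  by_cases hbig : 2 ≤ n ∧ 32 * (n : ℝ) ^ 2 * 2 ^ n < lam
  · exact RoundSphere.exists_thin_nodal_domain hbig.1 hlam hbig.2 hR hRl
  · refine RoundSphere.exists_nodal_domain_of_sqrt_pow_le hlam hR (by positivity) ?_
    have h1 : √lam ^ (n - 1) ≤ (4 * n * √(32 * n ^ 2 * 2 ^ n)) ^ (n - 1) := by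
      rcases not_and_or.mp hbig with h | h
      · simp [show n - 1 = 0 by omega]
      · refine pow_le_pow_left₀ (Real.sqrt_nonneg _) ?_ _
        refine (Real.sqrt_le_sqrt (not_lt.mp h)).trans ?_
        exact le_mul_of_one_le_left (Real.sqrt_nonneg _) (by linarith)
    exact h1.trans (le_mul_of_one_le_left (by positivity) (by linarith))
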